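/- Let $X$ be a finite alphabet with a fixed linear order, and let $X^{-\omega}$ be the space of left-infinite words $\ldots x_2x_1$ over $X$ with the product topology. Let $\mathcal L=(K,X,\{F_i\}_{i\in X})$ be a self-similar structure: $K$ is a compact metrizable space, the $F_i:K\to K$ are continuous injections, and there is a continuous surjection $\pi:X^{-\omega}\to K$ with $F_i(\pi(\ldots x_2x_1))=\pi(\ldots x_2x_1i)$ for all $i\in X$ (the associated surjection). Let $\sigma(\ldots x_2x_1)=\ldots x_3x_2$ and $\mathcal C=\pi^{-1}\big(\bigcup_{i\ne j}F_i(K)\cap F_j(K)\big)$. Assume that $\mathcal L$ is post-critically finite, i.e. $\bigcup_{n\ge1}\sigma^n(\mathcal C)$ is finite, and that the shift map $\mathsf s:K\to K$, $\mathsf s\circ\pi=\pi\circ\sigma$, is well defined. Then for every $\alpha\in\pi(\mathcal C)$ there are unique $n,k\ge1$, a unique word $z=z_k\ldots z_1$ over $X$ that is not a proper power, and unique sets $S_1,\dots,S_n\subseteq X$ with $z_k\notin S_n$, such that $$\pi^{-1}(\alpha)=\{\ldots zzz\,\zeta_n\ldots\zeta_1:\ \zeta_j\in S_j\}.$$ Let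 $\sigma_S$ denote the cyclic permutation $(s_1\,s_2\ldots s_m)$ of $S=\{s_1<\dots<s_m\}\subseteq X$, put $g_{\alpha,0}=1$, and define automorphisms $g_{\alpha,1},\dots,g_{\alpha,n+k-1}$ of the rooted tree $X^*$ by the following rules, where $g\cdot x=y\cdot h$ means $g(xw)=y\,h(w)$ for all words $w$: * for $1\le j\le n-1$ (Type I): $g_{\alpha,j}\cdot x=\sigma_{S_j}(x)\cdot g_{\alpha,j-1}$ if $x\in S_j$, and $x\cdot1$ otherwise; * for $j=n$ (Type II): $g_{\alpha,n}\cdot x=\sigma_{S_n}(x)\cdot g_{\alpha,n-1}$ if $x\in S_n$, $x\cdot g_{\alpha,n+k-1}$ if $x=z_k$, and $x\cdot1$ otherwise; * for $n<j\le n+k-1$ (Type II): $g_{\alpha,j}\cdot x=x\cdot g_{\alpha,j-1}$ if $x=z_{j-n}$, and $x\cdot1$ otherwise. Let $G_{\mathcal L}\le\operatorname{Aut}X^*$ be the group generated by all the $g_{\alpha,j}$, $\alpha\in\pi(\mathcal C)$. Then: 1. $G_{\mathcal L}$ is self-similar (closed under taking restrictions $g|_x$, $x\in X$) and contracting: there is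 a finite set $N\subset G_{\mathcal L}$ such that for every $g\in G_{\mathcal L}$ there is a $k$ with $g|_w\in N$ for all words $w$ with $|w|\ge k$. 2. Let $\mathcal J$ be the limit space of $G_{\mathcal L}$, i.e. the quotient space of $X^{-\omega}$ in which $\ldots x_2x_1$ and $\ldots y_2y_1$ are identified if and only if there is a sequence $(g_m)_{m\geq 1}$ in $G_{\mathcal L}$ taking finitely many values with $g_m(x_m\ldots x_1)=y_m\ldots y_1$ for all $m\ge1$; let $p:X^{-\omega}\to\mathcal J$ be the quotient map. Then $p(x)=p(y)$ if and only if $\pi(x)=\pi(y)$, for all $x,y\in X^{-\omega}$. 3. There are maps $F_i':\mathcal J\to\mathcal J$, $i\in X$, such that $\mathcal L'=(\mathcal J,X,\{F_i'\}_{i\in X})$ is a self-similar structure with associated surjection $p$, and $\mathcal L'$ is isomorphic to $\mathcal L$: $p\circ\pi^{-1}$ is a well-defined homeomorphism from $K$ onto $\mathcal J$. -/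

import Mathlib

noncomputable section

namespace SelfSim

universe u v

/-! ### Left-infinite words and self-similar structures -/

section Words

variable {X : Type u}

/-- The word `… x₃ x₂ x₁` is coded by `fun i => x_{i+1}`.  With the product topology (and a discrete
alphabet) this is the space of left-infinite words. -/
abbrev LeftWord (X : Type u) : Type u := ℕ → X

/-- `σ (… x₂ x₁) = … x₃ x₂`. -/
def shift (x : LeftWord X) : LeftWord X := fun n => x (n + 1)

/-- `… x₂ x₁ ↦ … x₂ x₁ i`. -/
def appendLetter (i : X) (x : LeftWord X) : LeftWord X
  | 0 => i
  | n + 1 => x n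

/-- The finite word `x_k … x₂ x₁`.  A finite word is a list whose head is its leftmost letter. -/
def trunc (x : LeftWord X) : ℕ → List X
  | 0 => []
  | k + 1 => x k :: trunc x k

variable {K : Type v} [TopologicalSpace X] [TopologicalSpace K]

/-- `π` is a continuous surjection with `F_i ∘ π = π ∘ i` for every letter `i`. -/
structure IsAssociatedSurjection (F : X → K → K) (π : LeftWord X → K) : Prop where
  continuous : Continuous π
  surjective : Function.Surjective π
  comm : ∀ i x, F i (π x) = π (appendLetter i x)

/-- `(K, X, (F_i))` is a self-similar structure on `K`. -/
structure IsSelfSimilarStructure (F : X → K → K) : Prop where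
  compactSpace : CompactSpace K
  metrizableSpace : TopologicalSpace.MetrizableSpace K
  continuous : ∀ i, Continuous (F i)
  injective : ∀ i, Function.Injective (F i)
  exists_surjection : ∃ π : LeftWord X → K, IsAssociatedSurjection F π

/-- Isomorphism of self-similar structures: for some bijection `ρ` of the alphabets,
`π₂ ∘ ι_ρ ∘ π₁⁻¹` is a well-defined homeomorphism. -/
def AreIsomorphic {X₁ X₂ : Type*} {K₁ K₂ : Type*} [TopologicalSpace X₁] [TopologicalSpace X₂]
    [TopologicalSpace K₁] [TopologicalSpace K₂] (F₁ : X₁ → K₁ → K₁) (F₂ : X₂ → K₂ → K₂) : Prop :=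
  ∃ (π₁ : LeftWord X₁ → K₁) (π₂ : LeftWord X₂ → K₂),
    IsAssociatedSurjection F₁ π₁ ∧ IsAssociatedSurjection F₂ π₂ ∧
    ∃ (ρ : X₁ ≃ X₂) (h : K₁ ≃ₜ K₂), ∀ x : LeftWord X₁, h (π₁ x) = π₂ (fun n => ρ (x n))

end Words

section Critical

variable {X : Type u} {K : Type v}

/-- `𝒞 = π⁻¹ (⋃_{i ≠ j} F_i(K) ∩ F_j(K))`. -/
def criticalSet (F : X → K → K) (π : LeftWord X → K) : Set (LeftWord X) :=
  π ⁻¹' {a | ∃ i j, i ≠ j ∧ a ∈ Set.range (F i) ∩ Set.range (F j)}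

/-- `𝒫 = ⋃_{n ≥ 1} σⁿ(𝒞)`. -/
def postCriticalSet (F : X → K → K) (π : LeftWord X → K) : Set (LeftWord X) :=
  {x | ∃ n : ℕ, 1 ≤ n ∧ x ∈ shift^[n] '' criticalSet F π}

/-- Post-critically finite. -/
def IsPCF (F : X → K → K) (π : LeftWord X → K) : Prop := (postCriticalSet F π).Finite

end Critical

/-! ### Automorphisms of the rooted tree of finite words -/

section Tree

variable {X : Type u}

/-- Every word `w` is joined to the words `w x`, `x ∈ X`. -/
def TreeAdj (u v : List X) : Prop := (∃ x, v = u ++ [x]) ∨ ∃ x, u = v ++ [x]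

/-- The group `Aut X^*`: the permutations of `X^*` that fix the empty word and preserve
adjacency. -/
def treeAut (X : Type u) : Subgroup (Equiv.Perm (List X)) where
  carrier := {g | g [] = [] ∧ ∀ u v, TreeAdj (g u) (g v) ↔ TreeAdj u v}
  one_mem' := by simp
  mul_mem' := by
    rintro a b ⟨ha, ha'⟩ ⟨hb, hb'⟩
    refine ⟨by simp [ha, hb], fun u v => ?_⟩
    rw [Equiv.Perm.mul_apply, Equiv.Perm.mul_apply, ha', hb']
  inv_mem' := by
    rintro a ⟨ha, ha'⟩
    refine ⟨by rw [Equiv.Perm.inv_eq_iff_eq, ha], fun u v => ?_⟩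
    rw [← ha']
    simp

/-- `h = g|_v`, that is, `g (v w) = g(v) h(w)` for all words `w`. -/
def IsRestriction (g : treeAut X) (v : List X) (h : treeAut X) : Prop :=
  ∀ w, g.1 (v ++ w) = g.1 v ++ h.1 w

/-- A group of automorphisms of `X^*` is self-similar: for `g ∈ G` and `x ∈ X` there are `h ∈ G` and
`y ∈ X` with `g (x w) = y h(w)` for all `w`. -/
def IsSelfSimilarGroup (G : Subgroup (treeAut X)) : Prop :=
  ∀ g ∈ G, ∀ x : X, ∃ h ∈ G, ∃ y : X, ∀ w, g.1 (x :: w) = y :: h.1 w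

/-- There is a finite `N ⊆ G` such that for every `g ∈ G` there is a `k` with `g|_w ∈ N` for all
words `w` of length at least `k`. -/
def IsContracting (G : Subgroup (treeAut X)) : Prop :=
  IsSelfSimilarGroup G ∧
  ∃ N : Set (treeAut X), N.Finite ∧ N ⊆ G ∧
    ∀ g ∈ G, ∃ k : ℕ, ∀ w : List X, k ≤ w.length → ∃ h ∈ N, IsRestriction g w h

/-- Asymptotic equivalence of left-infinite words. -/
def AsympEquiv (G : Subgroup (treeAut X)) (x y : LeftWord X) : Prop :=
  ∃ g : ℕ → treeAut X, (∀ k, g k ∈ G) ∧ (Set.range g).Finite ∧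
    ∀ k, (g k).1 (trunc x k) = trunc y k

/-- Asymptotic equivalence as an equivalence relation. -/
def asympSetoid (G : Subgroup (treeAut X)) : Setoid (LeftWord X) where
  r := AsympEquiv G
  iseqv :=
    { refl := fun _ => ⟨fun _ => 1, fun _ => G.one_mem, Set.finite_range_const, fun _ => rfl⟩
      symm := by
        rintro x y ⟨g, hg, hf, h⟩
        refine ⟨fun k => (g k)⁻¹, fun k => G.inv_mem (hg k), ?_, fun k => ?_⟩
        · have := hf.image (fun a => a⁻¹)
          rwa [← Set.range_comp] at this
        · change (g k).1⁻¹ _ = _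
          rw [Equiv.Perm.inv_eq_iff_eq, h]
      trans := by
        rintro x y z ⟨g, hg, hf, h⟩ ⟨g', hg', hf', h'⟩
        refine ⟨fun k => g' k * g k, fun k => G.mul_mem (hg' k) (hg k), ?_, fun k => ?_⟩
        · refine (Set.Finite.image2 (fun a b => a * b) hf' hf).subset ?_
          rintro _ ⟨k, rfl⟩
          exact ⟨g' k, ⟨k, rfl⟩, g k, ⟨k, rfl⟩, rfl⟩
        · change (g' k).1 ((g k).1 _) = _
          rw [h, h'] }

/-- The limit space, with the quotient topology. -/
def LimitSpace (G : Subgroup (treeAut X)) : Type u := Quotient (asympSetoid G)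

instance limitSpaceTopology [TopologicalSpace X] (G : Subgroup (treeAut X)) :
    TopologicalSpace (LimitSpace G) :=
  inferInstanceAs (TopologicalSpace (Quotient (asympSetoid G)))

/-- The quotient map `p` onto the limit space. -/
def limitProj (G : Subgroup (treeAut X)) (x : LeftWord X) : LimitSpace G :=
  Quotient.mk (asympSetoid G) x

end Tree

/-! ### Tree automorphisms given by wreath recursions -/

/-- A system of wreath recursions `q = perm q · (next q x)_{x ∈ X}`, indexed by the states `q`. -/
structure WreathRecursion (X : Type u) (Q : Type v) where
  perm : Q → Equiv.Perm X
  next : Q → X → Q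

namespace WreathRecursion

variable {X : Type u} {Q : Type v}

/-- The action `q (x w) = (perm q x) (next q x)(w)` of the state `q` on finite words. -/
def act (A : WreathRecursion X Q) : Q → List X → List X
  | _, [] => []
  | q, x :: w => A.perm q x :: A.act (A.next q x) w

/-- The recursions of the inverse automorphisms. -/
def inv (A : WreathRecursion X Q) : WreathRecursion X Q where
  perm q := (A.perm q)⁻¹
  next q y := A.next q ((A.perm q)⁻¹ y)

theorem inv_act_act (A : WreathRecursion X Q) (q : Q) (w : List X) :
    A.inv.act q (A.act q w) = w := by
  induction w generalizing q with
  | nil => rfl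
  | cons x w ih => simp [act, inv] at ih ⊢; exact ih _

theorem act_inv_act (A : WreathRecursion X Q) (q : Q) (w : List X) :
    A.act q (A.inv.act q w) = w := by
  induction w generalizing q with
  | nil => rfl
  | cons x w ih => simp [act, inv] at ih ⊢; exact ih _

theorem act_append_singleton (A : WreathRecursion X Q) (q : Q) (w : List X) (x : X) :
    ∃ y, A.act q (w ++ [x]) = A.act q w ++ [y] := by
  induction w generalizing q with
  | nil => exact ⟨_, rfl⟩
  | cons a w ih =>
    obtain ⟨y, hy⟩ := ih (A.next q a)
    exact ⟨y, by simp [act, hy]⟩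

theorem act_adj (A : WreathRecursion X Q) (q : Q) {u v : List X} (h : TreeAdj u v) :
    TreeAdj (A.act q u) (A.act q v) := by
  rcases h with ⟨x, rfl⟩ | ⟨x, rfl⟩
  · exact Or.inl (A.act_append_singleton q u x)
  · exact Or.inr (A.act_append_singleton q v x)

/-- The tree automorphism defined by the state `q`. -/
def aut (A : WreathRecursion X Q) (q : Q) : treeAut X :=
  ⟨{ toFun := A.act q
     invFun := A.inv.act q
     left_inv := A.inv_act_act q
     right_inv := A.act_inv_act q },
   rfl, fun u v => ⟨fun h => by
      have := A.inv.act_adj q h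
      simpa [inv_act_act] using this, A.act_adj q⟩⟩

end WreathRecursion

/-! ### The group attached to a post-critically finite self-similar structure -/

/-- The data `S₁, …, S_n` and `z = z_k … z₂ z₁` of a set of words written as
`… z z z S_n … S₂ S₁`. -/
structure ClassForm (X : Type u) where
  /-- The list `[S₁, …, S_n]`. -/
  S : List (Finset X)
  /-- The list `[z₁, …, z_k]`. -/
  z : List X

namespace ClassForm

variable {X : Type u}

/-- `n`. -/
def n (D : ClassForm X) : ℕ := D.S.length

/-- `k`. -/
def k (D : ClassForm X) : ℕ := D.z.length

/-- The set `… z z z S_n … S₂ S₁` of all words `… z z z ζ_n … ζ₂ ζ₁` with `ζ_j ∈ S_j`. -/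
def words (D : ClassForm X) : Set (LeftWord X) :=
  {x | (∀ (i : ℕ) (hi : i < D.S.length), x i ∈ D.S[i]) ∧
    ∀ i : ℕ, D.z[i % D.k]? = some (x (D.n + i))}

/-- The normalization: `n, k ≥ 1`, the word `z` is not a proper power, and `z_k ∉ S_n`. -/
structure IsReduced (D : ClassForm X) : Prop where
  S_ne_nil : D.S ≠ []
  z_ne_nil : D.z ≠ []
  primitive : ∀ (v : List X) (m : ℕ), 1 < m → D.z ≠ (List.replicate m v).flatten
  last_notMem : D.z.getLast z_ne_nil ∉ D.S.getLast S_ne_nil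

variable [LinearOrder X]

/-- The cyclic permutation `(s₁ s₂ … s_m)` of `S = {s₁ < s₂ < … < s_m}`. -/
def cyc (S : Finset X) : Equiv.Perm X := (S.sort (· ≤ ·)).formPerm

/-- The set `S_j` (empty if `j` is not in `1, …, n`). -/
def setAt (D : ClassForm X) (j : ℕ) : Finset X :=
  if j = 0 then ∅ else D.S.getD (j - 1) ∅

/-- `x = z_j`, where `1 ≤ j ≤ k`. -/
def IsLetter (D : ClassForm X) (j : ℕ) (x : X) : Prop :=
  1 ≤ j ∧ D.z[j - 1]? = some x

open Classical in
/-- The wreath recursions of `g_j`, `1 ≤ j ≤ n + k - 1`; the state `0` is the identity.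
* `1 ≤ j < n`: `g_j · x = σ_{S_j}(x) · g_{j-1}` for `x ∈ S_j`, and `x · 1` otherwise;
* `j = n`: `g_n · x = σ_{S_n}(x) · g_{n-1}` for `x ∈ S_n`, `x · g_{n+k-1}` for `x = z_k`, and `x · 1`
  otherwise;
* `n < j ≤ n + k - 1`: `g_j · x = x · g_{j-1}` for `x = z_{j-n}`, and `x · 1` otherwise. -/
def recursion (D : ClassForm X) : WreathRecursion X ℕ where
  perm j := cyc (D.setAt j)
  next j x :=
    if x ∈ D.setAt j then j - 1
    else if j = D.n ∧ D.IsLetter D.k x then D.n + D.k - 1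
    else if D.n < j ∧ D.IsLetter (j - D.n) x then j - 1
    else 0

/-- The generator `g_j`: of Type I if `1 ≤ j ≤ n - 1`, of Type II if `n ≤ j ≤ n + k - 1`. -/
def gen (D : ClassForm X) (j : ℕ) : treeAut X := D.recursion.aut j

end ClassForm

section Group

variable {X : Type u} [LinearOrder X] {K : Type v}

/-- `D` is the normal form of the fibre `π⁻¹(α)`. -/
def IsFormOf (π : LeftWord X → K) (α : K) (D : ClassForm X) : Prop :=
  D.IsReduced ∧ π ⁻¹' {α} = D.words

/-- The Type I and Type II generators `g_{α,j}`, for `α ∈ π(𝒞)` and `1 ≤ j ≤ n + k - 1`. -/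
def generators (F : X → K → K) (π : LeftWord X → K) : Set (treeAut X) :=
  {g | ∃ α ∈ π '' criticalSet F π, ∃ D : ClassForm X, IsFormOf π α D ∧
    ∃ j : ℕ, 1 ≤ j ∧ j ≤ D.n + D.k - 1 ∧ g = D.gen j}

/-- The group `G_ℒ`. -/
def structureGroup (F : X → K → K) (π : LeftWord X → K) : Subgroup (treeAut X) :=
  Subgroup.closure (generators F π)

end Group

end SelfSim

end

/-! Both appending a letter and shifting respect equality of `π`-values. Hence two words of one
fibre may exchange tails (`apply_splice_of_eq`). A finite fibre over a critical point is therefore a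
product: its words share an eventually periodic tail, and the finitely many letters before it vary
independently. The least possible preperiod and period give the normal form (`exists_isFormOf`), and
comparison of periods makes it unique (`eq_of_words_eq`).

Contraction: let `T` be a common multiple of all the `n * k`. Type I generators have trivial
sections at words of length `T`. A Type II generator reproduces itself along one word of length `T`
and has a Type I or trivial section at every other one. Passing to such sections in a product
removes the finitary factors, and then either lowers the number of directed factors or shows that
all of them follow the same word, so that the product lies in a finite group
(`isContracting_closure`).

Equal `π`-values imply equal `p`-values: one state per truncation rotates every `S_j` of a fibre at
once and has trivial section there, so the equivalences obtained survive appending letters. Rotating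
until the last letters agree, deleting that letter and repeating joins any two words of a fibre
(`rigidEquiv_of_eq`).

Conversely, finitely many group elements are products of boundedly many generators. By compactness
an asymptotic equivalence becomes a finite chain of left-infinite words, neighbours being labels of
left-infinite automaton paths (`eq_of_asympEquiv`). Read backwards from state `1`, the states of a
path are forced, so a path leaving `1` through `S_1` joins two words of one fibre; other paths
reduce to this case by appending or deleting letters (`eq_of_isPath`).

Finally `π` and `p` are quotient maps with the same fibres, so `K` and the limit space are
homeomorphic and the maps `F_i` are transported. -/

noncomputable section

namespace SelfSim

universe u v

/-! ### Sections of tree automorphisms -/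

section Sections

variable {X : Type u}

theorem mul_apply' (g h : treeAut X) (w : List X) : (g * h).1 w = g.1 (h.1 w) := rfl

theorem inv_apply_apply' (g : treeAut X) (w : List X) : (g⁻¹).1 (g.1 w) = w :=
  g.1.symm_apply_apply w

theorem apply_inv_apply' (g : treeAut X) (w : List X) : g.1 ((g⁻¹).1 w) = w :=
  g.1.apply_symm_apply w

theorem treeAut_ext {g h : treeAut X} (H : ∀ w, g.1 w = h.1 w) : g = h :=
  Subtype.ext (Equiv.ext H)

theorem treeAut_apply_nil (g : treeAut X) : g.1 [] = [] := g.2.1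

theorem treeAdj_append_left (c a b : List X) : TreeAdj (c ++ a) (c ++ b) ↔ TreeAdj a b := by
  simp [TreeAdj, List.append_assoc]

/-- Adjacency could fail to go downwards only if the image of `u a x` were the parent of the image
of `u a`. By induction that parent is the image of `u`, against injectivity. -/
theorem exists_apply_append_singleton (g : treeAut X) (u : List X) (x : X) :
    ∃ y, g.1 (u ++ [x]) = g.1 u ++ [y] := by
  induction u using List.reverseRecOn generalizing x with
  | nil =>
    have h : TreeAdj (g.1 []) (g.1 ([] ++ [x])) := (g.2.2 _ _).2 (Or.inl ⟨x, rfl⟩)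
    rcases h with ⟨y, hy⟩ | ⟨y, hy⟩
    · exact ⟨y, hy⟩
    · rw [treeAut_apply_nil] at hy
      simp at hy
  | append_singleton u a ih =>
    have h : TreeAdj (g.1 (u ++ [a])) (g.1 (u ++ [a] ++ [x])) := (g.2.2 _ _).2 (Or.inl ⟨x, rfl⟩)
    rcases h with ⟨y, hy⟩ | ⟨y, hy⟩
    · exact ⟨y, hy⟩
    · obtain ⟨b, hb⟩ := ih a
      rw [hb] at hy
      have h1 := (List.append_inj' hy rfl).1
      have h2 := congrArg List.length (g.1.injective h1)
      simp at h2

theorem exists_apply_append (g : treeAut X) (v w : List X) :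
    ∃ w', w'.length = w.length ∧ g.1 (v ++ w) = g.1 v ++ w' := by
  induction w using List.reverseRecOn with
  | nil => exact ⟨[], rfl, by simp⟩
  | append_singleton w a ih =>
    obtain ⟨w', hl, hw⟩ := ih
    obtain ⟨y, hy⟩ := exists_apply_append_singleton g (v ++ w) a
    refine ⟨w' ++ [y], by simp [hl], ?_⟩
    rw [← List.append_assoc, hy, hw, List.append_assoc]

theorem length_apply (g : treeAut X) (w : List X) : (g.1 w).length = w.length := by
  obtain ⟨w', hl, hw⟩ := exists_apply_append g [] w
  rw [List.nil_append, treeAut_apply_nil, List.nil_append] at hw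
  rw [hw, hl]

theorem apply_append_eq_drop (g : treeAut X) (v w : List X) :
    g.1 (v ++ w) = g.1 v ++ (g.1 (v ++ w)).drop v.length := by
  obtain ⟨w', -, hw⟩ := exists_apply_append g v w
  rw [hw, List.drop_left' (length_apply g v)]

/-- The section (restriction) `g|_v`. -/
def sec (g : treeAut X) (v : List X) : treeAut X :=
  ⟨{ toFun := fun w => (g.1 (v ++ w)).drop v.length
     invFun := fun w => ((g⁻¹).1 (g.1 v ++ w)).drop v.length
     left_inv := fun w => by
      simp only
      rw [← apply_append_eq_drop, inv_apply_apply', List.drop_left]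
     right_inv := fun w => by
      have h := apply_append_eq_drop g⁻¹ (g.1 v) w
      rw [inv_apply_apply', length_apply] at h
      simp only
      rw [← h, apply_inv_apply', List.drop_left' (length_apply g v)] },
   by
    change (g.1 (v ++ [])).drop v.length = []
    rw [List.append_nil, ← length_apply g v, List.drop_length],
   fun a b => by
    change TreeAdj ((g.1 (v ++ a)).drop v.length) ((g.1 (v ++ b)).drop v.length) ↔ _
    rw [← treeAdj_append_left (g.1 v), ← apply_append_eq_drop, ← apply_append_eq_drop, g.2.2,
      treeAdj_append_left]⟩

theorem apply_append (g : treeAut X) (v w : List X) :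
    g.1 (v ++ w) = g.1 v ++ (sec g v).1 w :=
  apply_append_eq_drop g v w

theorem eq_sec {g h : treeAut X} {v : List X} (H : IsRestriction g v h) : sec g v = h := by
  refine treeAut_ext fun w => ?_
  have := H w
  rw [apply_append] at this
  exact List.append_cancel_left this

theorem isRestriction_sec (g : treeAut X) (v : List X) : IsRestriction g v (sec g v) :=
  apply_append g v

theorem sec_one (v : List X) : sec (1 : treeAut X) v = 1 := eq_sec fun _ => rfl

theorem sec_nil (g : treeAut X) : sec g [] = g :=
  eq_sec fun w => by rw [treeAut_apply_nil]; rfl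

theorem sec_mul (g h : treeAut X) (v : List X) : sec (g * h) v = sec g (h.1 v) * sec h v :=
  eq_sec fun w => by
    rw [mul_apply', mul_apply', apply_append, apply_append]
    rfl

theorem sec_append (g : treeAut X) (v w : List X) : sec g (v ++ w) = sec (sec g v) w :=
  eq_sec fun w' => by
    rw [List.append_assoc, apply_append, apply_append (sec g v), apply_append g v w,
      List.append_assoc]

theorem sec_inv (g : treeAut X) (v : List X) : sec g⁻¹ v = (sec g ((g⁻¹).1 v))⁻¹ := by
  rw [eq_inv_iff_mul_eq_one]
  have h := sec_mul g⁻¹ g ((g⁻¹).1 v)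
  rw [apply_inv_apply', inv_mul_cancel, sec_one] at h
  exact h.symm

theorem sec_mem_of_isSelfSimilarGroup {G : Subgroup (treeAut X)} (hG : IsSelfSimilarGroup G)
    {g : treeAut X} (hg : g ∈ G) (v : List X) : sec g v ∈ G := by
  induction v generalizing g with
  | nil => rwa [sec_nil]
  | cons x v ih =>
    obtain ⟨h, hh, y, hy⟩ := hG g hg x
    have hgx : g.1 [x] = [y] := by rw [hy, treeAut_apply_nil]
    have : sec g [x] = h := eq_sec fun w => by rw [hgx]; exact hy w
    rw [← List.singleton_append, sec_append, this]
    exact ih hh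

theorem isSelfSimilarGroup_closure {A : Set (treeAut X)}
    (hA : ∀ g ∈ A, ∀ x, sec g [x] ∈ Subgroup.closure A) :
    IsSelfSimilarGroup (Subgroup.closure A) := by
  have key : ∀ g ∈ Subgroup.closure A, ∀ x, sec g [x] ∈ Subgroup.closure A := by
    have hlen : ∀ (g : treeAut X) (x : X), ∃ y, g.1 [x] = [y] := fun g x => by
      rw [← List.length_eq_one_iff, length_apply]; rfl
    intro g hg
    induction hg using Subgroup.closure_induction with
    | mem g hg => exact hA g hg
    | one => intro x; rw [sec_one]; exact Subgroup.one_mem _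
    | mul g h _ _ ihg ihh =>
      intro x
      obtain ⟨y, hy⟩ := hlen h x
      rw [sec_mul, hy]
      exact Subgroup.mul_mem _ (ihg y) (ihh x)
    | inv g _ ih =>
      intro x
      obtain ⟨y, hy⟩ := hlen g⁻¹ x
      rw [sec_inv, hy]
      exact Subgroup.inv_mem _ (ih y)
  intro g hg x
  have hlen : (g.1 [x]).length = 1 := length_apply g [x]
  obtain ⟨y, hy⟩ := List.length_eq_one_iff.1 hlen
  refine ⟨sec g [x], key g hg x, y, fun w => ?_⟩
  rw [← List.singleton_append, apply_append, hy, List.singleton_append]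

end Sections

/-! ### A contraction criterion -/

section Contraction

variable {X : Type u}

/-- The automorphisms that act only on the first `T` levels. -/
def finitary (X : Type u) (T : ℕ) : Subgroup (treeAut X) where
  carrier := {g | ∀ w : List X, w.length = T → sec g w = 1}
  one_mem' := fun w _ => sec_one w
  mul_mem' := by
    intro a b ha hb w hw
    rw [sec_mul, hb w hw, ha _ (by rw [length_apply, hw]), one_mul]
  inv_mem' := by
    intro a ha w hw
    rw [sec_inv, ha _ (by rw [length_apply, hw]), inv_one]

/-- The automorphisms that fix the word `u`, coincide with their section at `u`, and have sections
acting on the first `|u|` levels only at the other words of the same length. -/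
def directed (u : List X) : Subgroup (treeAut X) where
  carrier := {g | g.1 u = u ∧ sec g u = g ∧
    ∀ w : List X, w.length = u.length → w ≠ u → sec g w ∈ finitary X u.length}
  one_mem' := ⟨rfl, sec_one u, fun w _ _ => by rw [sec_one]; exact Subgroup.one_mem _⟩
  mul_mem' := by
    rintro a b ⟨ha, ha', ha''⟩ ⟨hb, hb', hb''⟩
    refine ⟨by rw [mul_apply', hb, ha], by rw [sec_mul, hb, ha', hb'], fun w hw hne => ?_⟩
    rw [sec_mul]
    refine Subgroup.mul_mem _ (ha'' _ (by rw [length_apply, hw]) fun h => hne ?_) (hb'' w hw hne)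
    exact b.1.injective (h.trans hb.symm)
  inv_mem' := by
    rintro a ⟨ha, ha', ha''⟩
    have hu : (a⁻¹).1 u = u := by
      conv_lhs => rw [← ha]
      exact inv_apply_apply' a u
    refine ⟨hu, by rw [sec_inv, hu, ha'], fun w hw hne => ?_⟩
    rw [sec_inv]
    refine Subgroup.inv_mem _ (ha'' _ (by rw [length_apply, hw]) fun h => hne ?_)
    rw [← apply_inv_apply' a w, h, ha]

theorem mem_directed {u : List X} {g : treeAut X} :
    g ∈ directed u ↔ g.1 u = u ∧ sec g u = g ∧
      ∀ w : List X, w.length = u.length → w ≠ u → sec g w ∈ finitary X u.length := Iff.rfl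

theorem finite_of_determined [Finite X] (s : Set (treeAut X)) (M : ℕ)
    (h : ∀ g ∈ s, ∀ g' ∈ s, (∀ w : List X, w.length ≤ M → g.1 w = g'.1 w) → g = g') :
    s.Finite := by
  have hfin : Finite {l : List X // l.length ≤ M} := (List.finite_length_le X M).to_subtype
  let f : treeAut X → {l : List X // l.length ≤ M} → {l : List X // l.length ≤ M} :=
    fun g l => ⟨g.1 l.1, by rw [length_apply]; exact l.2⟩
  refine Set.Finite.of_finite_image (f := f) (Set.toFinite _) fun g hg g' hg' hf => ?_
  refine h g hg g' hg' fun w hw => ?_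
  exact congrArg Subtype.val (congrFun hf ⟨w, hw⟩)

theorem eq_of_mem_finitary {T : ℕ} {g g' : treeAut X} (hg : g ∈ finitary X T)
    (hg' : g' ∈ finitary X T) (h : ∀ w : List X, w.length ≤ T → g.1 w = g'.1 w) : g = g' := by
  refine treeAut_ext fun w => ?_
  rcases le_total w.length T with hw | hw
  · exact h w hw
  · have hl : (w.take T).length = T := by simp [hw]
    rw [← List.take_append_drop T w, apply_append, apply_append, hg _ hl, hg' _ hl, h _ hl.le]

theorem finite_finitary [Finite X] (T : ℕ) : (finitary X T : Set (treeAut X)).Finite :=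
  finite_of_determined _ T fun _ hg _ hg' h => eq_of_mem_finitary hg hg' h

/-- Levels up to `2|u|` determine a directed element: they fix its finitary sections off `u`, and
its section at `u` is the element itself, so longer words are handled recursively. -/
theorem finite_directed [Finite X] {u : List X} (hu : u ≠ []) :
    (directed u : Set (treeAut X)).Finite := by
  refine finite_of_determined _ (u.length + u.length) fun g hg g' hg' h => ?_
  have hpos : 0 < u.length := List.length_pos_iff.2 hu
  obtain ⟨h1, h2, h3⟩ := mem_directed.1 hg
  obtain ⟨h1', h2', h3'⟩ := mem_directed.1 hg'
  have key : ∀ N, ∀ w : List X, w.length ≤ N → g.1 w = g'.1 w := by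
    intro N
    induction N with
    | zero => exact fun w hw => h w (by omega)
    | succ N ih =>
      intro w hw
      rcases lt_or_ge w.length u.length with hlt | hge
      · exact h w (by omega)
      · have hl : (w.take u.length).length = u.length := by simp [hge]
        rw [← List.take_append_drop u.length w, apply_append, apply_append,
          h _ (by rw [hl]; omega)]
        congr 1
        by_cases hwu : w.take u.length = u
        · rw [hwu, h2, h2']
          exact ih _ (by rw [List.length_drop]; omega)
        · rw [eq_of_mem_finitary (h3 _ hl hwu) (h3' _ hl hwu) fun w' hw' => ?_]
          have := h (w.take u.length ++ w') (by rw [List.length_append]; omega)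
          rw [apply_append, apply_append, h _ (by rw [hl]; omega)] at this
          exact List.append_cancel_left this
  exact treeAut_ext fun w => key _ w le_rfl

/-- The automorphisms that are finitary of depth `T` or directed along a word of length `T`. -/
def basicSet (X : Type u) (T : ℕ) : Set (treeAut X) :=
  {g | g ∈ finitary X T ∨ ∃ u : List X, u.length = T ∧ g ∈ directed u}

theorem finite_basicSet [Finite X] {T : ℕ} (hT : 0 < T) : (basicSet X T).Finite := by
  have hfin : {u : List X | u.length = T}.Finite := List.finite_length_eq X T
  refine ((finite_finitary T).union (hfin.biUnion (t := fun u => (directed u : Set (treeAut X)))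
    fun u hu => finite_directed ?_)).subset ?_
  · rintro rfl
    simp at hu
    omega
  · rintro g (hg | ⟨u, hu, hg⟩)
    · exact Or.inl hg
    · exact Or.inr (Set.mem_biUnion hu hg)

theorem sec_mem_basicSet {T : ℕ} {g : treeAut X} (hg : g ∈ basicSet X T) {w : List X}
    (hw : w.length = T) : sec g w ∈ basicSet X T := by
  rcases hg with hg | ⟨u, rfl, hg⟩
  · rw [hg w hw]
    exact Or.inl (Subgroup.one_mem _)
  · by_cases hwu : w = u
    · rw [hwu, hg.2.1]
      exact Or.inr ⟨u, rfl, hg⟩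
    · exact Or.inl (hg.2.2 w hw hwu)

/-- Products with at most `L` directed factors. -/
def mixedProd (T : ℕ) : ℕ → treeAut X → Prop
  | 0, g => g ∈ finitary X T
  | L + 1, g => ∃ r ∈ finitary X T, ∃ u : List X, u.length = T ∧ ∃ b ∈ directed u,
      ∃ h, mixedProd T L h ∧ g = r * (b * h)

/-- Products of `L` directed factors. -/
def directedProd (T : ℕ) : ℕ → treeAut X → Prop
  | 0, g => g = 1
  | L + 1, g => ∃ u : List X, u.length = T ∧ ∃ b ∈ directed u, ∃ h, directedProd T L h ∧ g = b * h

variable {T : ℕ}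

theorem mixedProd.finitary_mul {L : ℕ} {r g : treeAut X} (hr : r ∈ finitary X T)
    (hg : mixedProd T L g) : mixedProd T L (r * g) := by
  cases L with
  | zero => exact Subgroup.mul_mem _ hr hg
  | succ L =>
    obtain ⟨r', hr', u, hu, b, hb, h, hh, rfl⟩ := hg
    exact ⟨r * r', Subgroup.mul_mem _ hr hr', u, hu, b, hb, h, hh, by rw [mul_assoc]⟩

theorem mixedProd.directed_mul {L : ℕ} {u : List X} {b g : treeAut X} (hu : u.length = T)
    (hb : b ∈ directed u) (hg : mixedProd T L g) : mixedProd T (L + 1) (b * g) :=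
  ⟨1, Subgroup.one_mem _, u, hu, b, hb, g, hg, by rw [one_mul]⟩

theorem directedProd.mixedProd {L : ℕ} {g : treeAut X} (hg : directedProd T L g) :
    mixedProd T L g := by
  induction L generalizing g with
  | zero =>
    obtain rfl : g = 1 := hg
    exact Subgroup.one_mem _
  | succ L ih =>
    obtain ⟨u, hu, b, hb, h, hh, rfl⟩ := hg
    exact (ih hh).directed_mul hu hb

/-- Finitary factors disappear at depth `T`. A directed factor survives only if the word reaching it
is its own `u`; otherwise it turns finitary and the count drops. -/
theorem mixedProd.sec {L : ℕ} {g : treeAut X} (hg : mixedProd T L g) {w : List X}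
    (hw : w.length = T) :
    directedProd T L (sec g w) ∨ ∃ L' < L, SelfSim.mixedProd T L' (SelfSim.sec g w) := by
  induction L generalizing g with
  | zero => exact Or.inl (hg w hw)
  | succ L ih =>
    obtain ⟨r, hr, u, rfl, b, hb, h, hh, rfl⟩ := hg
    rw [sec_mul, hr _ (by rw [length_apply, hw]), one_mul, sec_mul]
    by_cases hu : h.1 w = u
    · rw [hu, hb.2.1]
      rcases ih hh with h1 | ⟨L', hL', h1⟩
      · exact Or.inl ⟨u, rfl, b, hb, _, h1, rfl⟩
      · exact Or.inr ⟨L' + 1, by omega, h1.directed_mul rfl hb⟩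
    · have hr' := hb.2.2 (h.1 w) (by rw [length_apply, hw]) hu
      rcases ih hh with h1 | ⟨L', hL', h1⟩
      · exact Or.inr ⟨L, by omega, h1.mixedProd.finitary_mul hr'⟩
      · exact Or.inr ⟨L', by omega, h1.finitary_mul hr'⟩

/-- The count stays the same only if every factor meets its own word. Directed factors fix their
words, so all these words then equal `w` and the product stays in the group `directed w`. -/
theorem directedProd.sec {L : ℕ} {g : treeAut X} (hg : directedProd T L g) {w : List X}
    (hw : w.length = T) :
    g ∈ directed w ∨ ∃ L' < L, SelfSim.mixedProd T L' (sec g w) := by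
  induction L generalizing g with
  | zero =>
    obtain rfl : g = 1 := hg
    exact Or.inl (Subgroup.one_mem _)
  | succ L ih =>
    obtain ⟨u, rfl, b, hb, h, hh, rfl⟩ := hg
    rw [sec_mul]
    rcases ih hh with h1 | ⟨L', hL', h1⟩
    · rw [h1.1, h1.2.1]
      by_cases hu : w = u
      · subst hu
        exact Or.inl (Subgroup.mul_mem _ hb h1)
      · exact Or.inr ⟨L, by omega, hh.mixedProd.finitary_mul (hb.2.2 w hw hu)⟩
    · by_cases hu : h.1 w = u
      · rw [hu, hb.2.1]
        exact Or.inr ⟨L' + 1, by omega, h1.directed_mul rfl hb⟩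
      · exact Or.inr ⟨L', by omega,
          h1.finitary_mul (hb.2.2 (h.1 w) (by rw [length_apply, hw]) hu)⟩

theorem exists_mixedProd {A : Set (treeAut X)} (hA : A ⊆ basicSet X T) {g : treeAut X}
    (hg : g ∈ Subgroup.closure A) : ∃ L, mixedProd T L g := by
  have hmul : ∀ a ∈ basicSet X T, ∀ g, (∃ L, mixedProd T L g) → ∃ L, mixedProd T L (a * g) := by
    rintro a (ha | ⟨u, hu, ha⟩) g ⟨L, hL⟩
    · exact ⟨L, hL.finitary_mul ha⟩
    · exact ⟨L + 1, hL.directed_mul hu ha⟩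
  induction hg using Subgroup.closure_induction_left with
  | one => exact ⟨0, Subgroup.one_mem _⟩
  | mul_left a ha g _ ih => exact hmul a (hA ha) g ih
  | inv_mul_cancel a ha g _ ih =>
    refine hmul a⁻¹ ?_ g ih
    rcases hA ha with h | ⟨u, hu, h⟩
    · exact Or.inl (Subgroup.inv_mem _ h)
    · exact Or.inr ⟨u, hu, Subgroup.inv_mem _ h⟩

/-- Sections at all words of length `m T`, for some `m`, are in the basic set. -/
def ContractsTo (T : ℕ) (g : treeAut X) : Prop :=
  ∃ m, ∀ w : List X, w.length = m * T → sec g w ∈ basicSet X T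

theorem contractsTo_of_mem {g : treeAut X} (hg : g ∈ basicSet X T) : ContractsTo T g :=
  ⟨0, fun w hw => by
    rw [zero_mul, List.length_eq_zero_iff] at hw
    rwa [hw, sec_nil]⟩

theorem sec_mem_basicSet_of_le {g : treeAut X} {m m' : ℕ} (hm : m ≤ m')
    (h : ∀ w : List X, w.length = m * T → sec g w ∈ basicSet X T) (w : List X)
    (hw : w.length = m' * T) : sec g w ∈ basicSet X T := by
  induction m', hm using Nat.le_induction generalizing w with
  | base => exact h w hw
  | succ m' _ ih =>
    rw [Nat.succ_mul] at hw
    rw [← List.take_append_drop (m' * T) w, sec_append]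
    exact sec_mem_basicSet (ih _ (by simp [hw])) (by simp [hw])

theorem contractsTo_of_sec [Finite X] {g : treeAut X}
    (h : ∀ w : List X, w.length = T → ContractsTo T (sec g w)) : ContractsTo T g := by
  choose! m hm using h
  obtain ⟨M, hM⟩ := ((List.finite_length_eq X T).image m).bddAbove
  refine ⟨M + 1, fun w hw => ?_⟩
  rw [Nat.succ_mul] at hw
  have hl : (w.take T).length = T := by simp [hw]
  rw [← List.take_append_drop T w, sec_append]
  exact sec_mem_basicSet_of_le (hM ⟨_, hl, rfl⟩) (hm _ hl) _ (by simp [hw])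

theorem mixedProd.contractsTo [Finite X] {L : ℕ} {g : treeAut X} (hg : mixedProd T L g) :
    ContractsTo T g := by
  induction L using Nat.strong_induction_on generalizing g with
  | _ L ih =>
    refine contractsTo_of_sec fun w hw => ?_
    rcases hg.sec hw with h | ⟨L', hL', h⟩
    · by_cases hd : ∃ w' : List X, w'.length = T ∧ SelfSim.sec g w ∈ directed w'
      · exact contractsTo_of_mem (Or.inr hd)
      · refine contractsTo_of_sec fun w' hw' => ?_
        rcases h.sec hw' with h' | ⟨L', hL', h'⟩
        · exact absurd ⟨w', hw', h'⟩ hd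
        · exact ih L' hL' h'
    · exact ih L' hL' h

/-- A self-similar group generated by elements of `basicSet X T` is contracting. -/
theorem isContracting_closure [Finite X] (hT : 0 < T) {A : Set (treeAut X)}
    (hA : A ⊆ basicSet X T) (hss : IsSelfSimilarGroup (Subgroup.closure A)) :
    IsContracting (Subgroup.closure A) := by
  -- Depths that are multiples of `T` lead into the basic set; the remaining fewer than `T` letters
  -- are absorbed by adding the sections at short words.
  refine ⟨hss, (Set.image2 sec (basicSet X T) {v : List X | v.length ≤ T}) ∩ Subgroup.closure A,
    ?_, Set.inter_subset_right, fun g hg => ?_⟩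
  · exact ((finite_basicSet hT).image2 _ (List.finite_length_le X T)).inter_of_left _
  · obtain ⟨L, hL⟩ := exists_mixedProd hA hg
    obtain ⟨m, hm⟩ := hL.contractsTo
    refine ⟨m * T, fun w hw => ⟨sec g w, ⟨?_, sec_mem_of_isSelfSimilarGroup hss hg w⟩,
      isRestriction_sec g w⟩⟩
    have hle : w.length / T * T ≤ w.length := Nat.div_mul_le_self _ _
    refine ⟨sec g (w.take (w.length / T * T)), ?_, w.drop (w.length / T * T), ?_, ?_⟩
    · exact sec_mem_basicSet_of_le ((Nat.le_div_iff_mul_le hT).2 hw) hm _ (by simp [hle])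
    · have h1 := Nat.mod_lt w.length hT
      have h2 := Nat.div_add_mod' w.length T
      rw [Set.mem_ofPred_eq, List.length_drop]
      omega
    · rw [← sec_append, List.take_append_drop]

end Contraction

/-! ### Left-infinite words -/

section LeftWords

variable {X : Type u}

theorem appendLetter_shift (x : LeftWord X) : appendLetter (x 0) (shift x) = x := by
  funext t
  cases t <;> rfl

theorem appendLetter_shift_of_eq {x : LeftWord X} {a : X} (h : x 0 = a) :
    appendLetter a (shift x) = x := by
  rw [← h, appendLetter_shift]

theorem shift_iterate_apply (n : ℕ) (x : LeftWord X) (t : ℕ) : shift^[n] x t = x (n + t) := by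
  induction n generalizing x with
  | zero => simp
  | succ n ih =>
    rw [Function.iterate_succ_apply, ih, shift]
    congr 1
    omega

@[simp] theorem length_trunc (x : LeftWord X) (m : ℕ) : (trunc x m).length = m := by
  induction m with
  | zero => rfl
  | succ m ih => simp [trunc, ih]

theorem trunc_eq_trunc_iff {x y : LeftWord X} {m : ℕ} :
    trunc x m = trunc y m ↔ ∀ t < m, x t = y t := by
  induction m with
  | zero => simp [trunc]
  | succ m ih =>
    rw [trunc, trunc, List.cons.injEq, ih, Nat.forall_lt_succ_right, and_comm]

theorem eq_of_forall_trunc_eq {x y : LeftWord X} (h : ∀ m, trunc x m = trunc y m) : x = y :=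
  funext fun t => trunc_eq_trunc_iff.1 (h (t + 1)) t t.lt_succ_self

theorem trunc_appendLetter (i : X) (x : LeftWord X) (m : ℕ) :
    trunc (appendLetter i x) (m + 1) = trunc x m ++ [i] := by
  induction m with
  | zero => rfl
  | succ m ih => rw [trunc, ih]; rfl

theorem exists_trunc_eq [Nonempty X] (w : List X) : ∃ x : LeftWord X, trunc x w.length = w := by
  induction w with
  | nil => exact ⟨fun _ => Classical.arbitrary X, rfl⟩
  | cons a w ih =>
    obtain ⟨x, hx⟩ := ih
    refine ⟨Function.update x w.length a, ?_⟩
    rw [List.length_cons, trunc, Function.update_self]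
    congr 1
    conv_rhs => rw [← hx]
    exact trunc_eq_trunc_iff.2 fun t ht => Function.update_of_ne ht.ne _ _

end LeftWords

/-! ### A compactness principle -/

/-- Each condition depends on finitely many coordinates and is thus closed in the compact product;
nested nonempty closed sets have a common point. -/
theorem exists_forall_of_local {Y : Type*} [Finite Y] (P : ℕ → (ℕ → Y) → Prop)
    (hanti : ∀ m y, P (m + 1) y → P m y)
    (hloc : ∀ m y y', (∀ t ≤ m, y t = y' t) → P m y → P m y')
    (hex : ∀ m, ∃ y, P m y) : ∃ y, ∀ m, P m y := by
  let _ : TopologicalSpace Y := ⊥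
  have : DiscreteTopology Y := ⟨rfl⟩
  have hcl : ∀ m, IsClosed {y | P m y} := fun m => by
    let f : (ℕ → Y) → (Fin (m + 1) → Y) := fun y i => y i
    have hf : Continuous f := by fun_prop
    have : {y | P m y} = f ⁻¹' (f '' {y | P m y}) := by
      refine (Set.subset_preimage_image _ _).antisymm ?_
      rintro y ⟨y', hy', h⟩
      exact hloc m y' y (fun t ht => congrFun h ⟨t, by omega⟩) hy'
    rw [this]
    exact (isClosed_discrete _).preimage hf
  obtain ⟨y, hy⟩ := IsCompact.nonempty_iInter_of_sequence_nonempty_isCompact_isClosed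
    (fun m => {y | P m y}) (fun m y hy => hanti m y hy) hex (hcl 0).isCompact hcl
  exact ⟨y, fun m => Set.mem_iInter.1 hy m⟩

/-- `L` steps of the relation `r`. -/
def stepChain {Y : Type*} (r : Y → Y → Prop) : ℕ → Y → Y → Prop
  | 0, u, v => u = v
  | L + 1, u, v => ∃ w, r u w ∧ stepChain r L w v

theorem stepChain.trans {Y : Type*} {r : Y → Y → Prop} {L M : ℕ} {u v w : Y}
    (h : stepChain r L u v) (h' : stepChain r M v w) : stepChain r (L + M) u w := by
  induction L generalizing u with
  | zero =>
    obtain rfl : u = v := h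
    rwa [zero_add]
  | succ L ih =>
    obtain ⟨a, ha, h⟩ := h
    rw [Nat.add_right_comm]
    exact ⟨a, ha, ih h⟩

theorem stepChain.mono {Y : Type*} {r : Y → Y → Prop} (hr : ∀ u, r u u) {L M : ℕ} (hLM : L ≤ M)
    {u v : Y} (h : stepChain r L u v) : stepChain r M u v := by
  induction M, hLM using Nat.le_induction with
  | base => exact h
  | succ M _ ih => exact ⟨u, hr u, ih⟩

/-! ### Chains of finite words and their left-infinite limits -/

section Chains

variable {X : Type u} {r : List X → List X → Prop}

theorem stepChain.of_cons (hlen : ∀ u v, r u v → u.length = v.length)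
    (hsuf : ∀ a b u v, r (a :: u) (b :: v) → r u v) {L : ℕ} {a b : X} {u v : List X}
    (h : stepChain r L (a :: u) (b :: v)) : stepChain r L u v := by
  induction L generalizing a u with
  | zero => exact (List.cons.inj h).2
  | succ L ih =>
    obtain ⟨w, hw, h⟩ := h
    cases w with
    | nil => simpa using hlen _ _ hw
    | cons c w => exact ⟨w, hsuf _ _ _ _ hw, ih h⟩

/-- The intermediate words of the chains may change with `m`. Since steps restrict to suffixes,
compactness selects one left-infinite word that serves as first intermediate word at every level. -/
theorem eq_of_forall_stepChain [Finite X] {K : Type v} {f : LeftWord X → K}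
    (hlen : ∀ u v, r u v → u.length = v.length) (hsuf : ∀ a b u v, r (a :: u) (b :: v) → r u v)
    (hf : ∀ x y, (∀ m, r (trunc x m) (trunc y m)) → f x = f y) {L : ℕ} {x y : LeftWord X}
    (h : ∀ m, stepChain r L (trunc x m) (trunc y m)) : f x = f y := by
  induction L generalizing x with
  | zero => rw [eq_of_forall_trunc_eq h]
  | succ L ih =>
    have : Nonempty X := ⟨x 0⟩
    obtain ⟨z, hz⟩ := exists_forall_of_local
      (fun m z => r (trunc x m) (trunc z m) ∧ stepChain r L (trunc z m) (trunc y m))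
      (fun m z hz => ⟨hsuf _ _ _ _ hz.1, hz.2.of_cons hlen hsuf⟩)
      (fun m z z' hzz' hz => by
        rwa [← trunc_eq_trunc_iff.2 fun t ht => hzz' t (le_of_lt ht)])
      (fun m => by
        obtain ⟨w, hw, hw'⟩ := h m
        obtain ⟨z, hz⟩ := exists_trunc_eq w
        have := hlen _ _ hw
        rw [length_trunc] at this
        rw [← this] at hz
        exact ⟨z, by rwa [hz], by rwa [hz]⟩)
    rw [hf x z fun m => (hz m).1, ih fun m => (hz m).2]

end Chains

/-! ### Left-infinite paths in automata -/

section Paths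

variable {X : Type u} {Q : Type v}

theorem WreathRecursion.act_cons (A : WreathRecursion X Q) (q : Q) (a : X) (w : List X) :
    A.act q (a :: w) = A.perm q a :: A.act (A.next q a) w := rfl

theorem WreathRecursion.sec_aut (A : WreathRecursion X Q) (q : Q) (a : X) :
    sec (A.aut q) [a] = A.aut (A.next q a) :=
  eq_sec fun _ => rfl

/-- A left-infinite path in the automaton with the label `(x, y)`. -/
def WreathRecursion.IsPath (A : WreathRecursion X Q) (x y : LeftWord X) (q : ℕ → Q) : Prop :=
  ∀ t, A.next (q (t + 1)) (x t) = q t ∧ A.perm (q (t + 1)) (x t) = y t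

theorem WreathRecursion.IsPath.shift {A : WreathRecursion X Q} {x y : LeftWord X} {q : ℕ → Q}
    (h : A.IsPath x y q) : A.IsPath (shift x) (shift y) fun t => q (t + 1) :=
  fun t => h (t + 1)

theorem WreathRecursion.IsPath.append {A : WreathRecursion X Q} {x y : LeftWord X} {q : ℕ → Q}
    (h : A.IsPath x y q) (a : X) :
    A.IsPath (appendLetter a x) (appendLetter (A.perm (q 0) a) y)
      (fun t => Nat.casesOn t (A.next (q 0) a) q) := by
  intro t
  cases t with
  | zero => exact ⟨rfl, rfl⟩
  | succ t => exact h t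

/-- The initial state may depend on `m`. Each run on a truncation gives a finite path ending at
index `0`, and compactness over the finitely many states below `N` yields an infinite one. -/
theorem WreathRecursion.exists_isPath (A : WreathRecursion X ℕ) {N : ℕ}
    (hN : ∀ j < N, ∀ a, A.next j a < N) {x y : LeftWord X}
    (h : ∀ m, ∃ j < N, A.act j (trunc x m) = trunc y m) :
    ∃ q, (∀ t, q t < N) ∧ A.IsPath x y q := by
  have key : ∀ m, ∀ j < N, A.act j (trunc x m) = trunc y m → ∃ q : ℕ → Fin N, (q m : ℕ) = j ∧
      ∀ t < m, A.next (q (t + 1)) (x t) = q t ∧ A.perm (q (t + 1)) (x t) = y t := by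
    intro m
    induction m with
    | zero => exact fun j hj _ => ⟨fun _ => ⟨j, hj⟩, rfl, by simp⟩
    | succ m ih =>
      intro j hj hjm
      rw [trunc, trunc, act_cons, List.cons.injEq] at hjm
      obtain ⟨q, hq, hq'⟩ := ih _ (hN j hj _) hjm.2
      -- Words are read from the left, that is, from the largest index down; the state before the
      -- letter `x m` therefore has index `m + 1`.
      refine ⟨Function.update q (m + 1) ⟨j, hj⟩, by simp, fun t ht => ?_⟩
      rw [Function.update_of_ne (a := t) (by omega)]
      rcases (Nat.lt_succ_iff_lt_or_eq.1 ht) with ht | rfl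
      · rw [Function.update_of_ne (by omega)]
        exact hq' t ht
      · rw [Function.update_self]
        exact ⟨hq.symm, hjm.1⟩
  obtain ⟨q, hq⟩ := exists_forall_of_local
    (fun m (q : ℕ → Fin N) => ∀ t < m, A.next (q (t + 1)) (x t) = q t ∧
      A.perm (q (t + 1)) (x t) = y t)
    (fun m q hq t ht => hq t (by omega))
    (fun m q q' hqq' hq t ht => by
      rw [← hqq' t (by omega), ← hqq' (t + 1) (by omega)]
      exact hq t ht)
    (fun m => by
      obtain ⟨j, hj, hjm⟩ := h m
      obtain ⟨q, -, hq⟩ := key m j hj hjm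
      exact ⟨q, hq⟩)
  exact ⟨fun t => q t, fun t => (q t).2, fun t => hq (t + 1) t t.lt_succ_self⟩

end Paths

/-! ### The recursions of a class form -/

namespace ClassForm

variable {X : Type u}

theorem IsReduced.one_le_n {D : ClassForm X} (hD : D.IsReduced) : 1 ≤ D.n :=
  List.length_pos_iff.2 hD.S_ne_nil

theorem IsReduced.one_le_k {D : ClassForm X} (hD : D.IsReduced) : 1 ≤ D.k :=
  List.length_pos_iff.2 hD.z_ne_nil

theorem isLetter_succ {D : ClassForm X} {j : ℕ} {x : X} :
    D.IsLetter (j + 1) x ↔ D.z[j]? = some x := by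
  simp [IsLetter]

theorem IsLetter.eq {D : ClassForm X} {j : ℕ} {x y : X} (hx : D.IsLetter j x)
    (hy : D.IsLetter j y) : x = y :=
  Option.some.inj (hx.2.symm.trans hy.2)

theorem exists_isLetter {D : ClassForm X} {j : ℕ} (h1 : 1 ≤ j) (h2 : j ≤ D.k) :
    ∃ x, D.IsLetter j x := by
  have : j - 1 < D.z.length := by
    change j ≤ D.z.length at h2
    omega
  exact ⟨D.z[j - 1], h1, List.getElem?_eq_getElem this⟩

theorem mem_setAt_succ {D : ClassForm X} {i : ℕ} (hi : i < D.S.length) {x : X} :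
    x ∈ D.setAt (i + 1) ↔ x ∈ D.S[i] := by
  simp [setAt, hi]

theorem setAt_zero (D : ClassForm X) : D.setAt 0 = ∅ := rfl

theorem setAt_eq_empty {D : ClassForm X} {j : ℕ} (h : D.n < j) : D.setAt j = ∅ := by
  unfold n at h
  rw [setAt, if_neg (by omega), List.getD_eq_default _ _ (by omega)]

theorem le_n_of_mem_setAt {D : ClassForm X} {j : ℕ} {x : X} (h : x ∈ D.setAt j) :
    1 ≤ j ∧ j ≤ D.n := by
  constructor
  · by_contra hj
    obtain rfl : j = 0 := by omega
    simp [setAt_zero] at h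
  · by_contra hj
    rw [setAt_eq_empty (by omega)] at h
    simp at h

theorem mem_words_iff {D : ClassForm X} {x : LeftWord X} :
    x ∈ D.words ↔ (∀ t < D.n, x t ∈ D.setAt (t + 1)) ∧
      ∀ i, D.IsLetter (i % D.k + 1) (x (D.n + i)) := by
  refine and_congr (forall_congr' fun t => forall_congr' fun ht => ?_)
    (forall_congr' fun i => isLetter_succ.symm)
  exact (mem_setAt_succ ht).symm

theorem IsReduced.notMem_of_isLetter {D : ClassForm X} (hD : D.IsReduced) {x : X}
    (hx : D.IsLetter D.k x) : x ∉ D.setAt D.n := by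
  have h1 : D.z.getLast hD.z_ne_nil = x := by
    rw [List.getLast_eq_getElem]
    have := hx.2
    rw [List.getElem?_eq_some_iff] at this
    exact this.2
  have h2 : D.S.getLast hD.S_ne_nil = D.setAt D.n := by
    have hn := hD.one_le_n
    unfold n at hn ⊢
    rw [List.getLast_eq_getElem, setAt, if_neg (by omega), List.getD_eq_getElem _ _ (by omega)]
  rw [← h1, ← h2]
  exact hD.last_notMem

/-- The state whose action on the first `m` letters extends to the words of the class form. -/
def state (D : ClassForm X) (m : ℕ) : ℕ := if m < D.n then m else D.n + (m - D.n) % D.k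

theorem state_of_le {D : ClassForm X} {t : ℕ} (h : t ≤ D.n) : D.state t = t := by
  unfold state
  split_ifs with h'
  · rfl
  · obtain rfl : t = D.n := by omega
    simp

theorem state_add {D : ClassForm X} (i : ℕ) : D.state (D.n + i) = D.n + i % D.k := by
  simp [state]

theorem state_lt {D : ClassForm X} (hD : D.IsReduced) (m : ℕ) : D.state m < D.n + D.k := by
  have := hD.one_le_k
  have := Nat.mod_lt (m - D.n) (y := D.k) (by omega)
  unfold state
  split_ifs <;> omega

theorem succ_mod_cases {k : ℕ} (hk : 1 ≤ k) (i : ℕ) :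
    (i % k + 1 < k ∧ (i + 1) % k = i % k + 1) ∨ (i % k + 1 = k ∧ (i + 1) % k = 0) := by
  have h := Nat.mod_lt i (y := k) (by omega)
  rcases Nat.lt_or_ge (i % k + 1) k with h' | h'
  · refine Or.inl ⟨h', ?_⟩
    rw [← Nat.mod_add_mod, Nat.mod_eq_of_lt h']
  · have h'' : i % k + 1 = k := by omega
    refine Or.inr ⟨h'', ?_⟩
    rw [← Nat.mod_add_mod, h'', Nat.mod_self]

variable [LinearOrder X]

theorem cyc_apply_mem {S : Finset X} {x : X} (h : x ∈ S) : cyc S x ∈ S := by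
  have h' : x ∈ S.sort (· ≤ ·) := (Finset.mem_sort _).2 h
  exact (Finset.mem_sort _).1 (List.formPerm_apply_mem_of_mem h')

theorem cyc_apply_of_notMem {S : Finset X} {x : X} (h : x ∉ S) : cyc S x = x :=
  List.formPerm_apply_of_notMem (fun h' => h ((Finset.mem_sort _).1 h'))

theorem exists_cyc_pow_apply {S : Finset X} {x y : X} (hx : x ∈ S) (hy : y ∈ S) :
    ∃ e : ℕ, (cyc S ^ e) x = y := by
  set l := S.sort (· ≤ ·) with hl
  have hnd : l.Nodup := Finset.sort_nodup _ _
  obtain ⟨i, hi, rfl⟩ := List.getElem_of_mem ((Finset.mem_sort (· ≤ ·)).2 hx)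
  obtain ⟨j, hj, rfl⟩ := List.getElem_of_mem ((Finset.mem_sort (· ≤ ·)).2 hy)
  change i < l.length at hi
  change j < l.length at hj
  refine ⟨j + (l.length - i), ?_⟩
  change (l.formPerm ^ _) l[i] = l[j]
  rw [List.formPerm_pow_apply_getElem _ hnd]
  congr 1
  rw [show i + (j + (l.length - i)) = j + l.length by omega, Nat.add_mod_right,
    Nat.mod_eq_of_lt hj]

/-! ### Transitions of the automaton of a class form -/

section Recursion

variable {D : ClassForm X}

theorem next_of_mem {j : ℕ} {x : X} (h : x ∈ D.setAt j) : D.recursion.next j x = j - 1 :=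
  if_pos h

theorem next_of_isLetter {j : ℕ} {x : X} (hj : D.n < j) (h : D.IsLetter (j - D.n) x) :
    D.recursion.next j x = j - 1 := by
  simp [recursion, setAt_eq_empty hj, hj.ne', hj, h]

theorem next_n_of_isLetter (hD : D.IsReduced) {x : X} (h : D.IsLetter D.k x) :
    D.recursion.next D.n x = D.n + D.k - 1 := by
  simp [recursion, hD.notMem_of_isLetter h, h]

theorem next_cases (j : ℕ) (x : X) :
    (x ∈ D.setAt j ∧ D.recursion.next j x = j - 1) ∨
    (x ∉ D.setAt j ∧ j = D.n ∧ D.IsLetter D.k x ∧ D.recursion.next j x = D.n + D.k - 1) ∨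
    (x ∉ D.setAt j ∧ D.n < j ∧ D.IsLetter (j - D.n) x ∧ D.recursion.next j x = j - 1) ∨
    (x ∉ D.setAt j ∧ D.recursion.next j x = 0 ∧ ¬ (j = D.n ∧ D.IsLetter D.k x) ∧
      ¬ (D.n < j ∧ D.IsLetter (j - D.n) x)) := by
  simp only [recursion]
  split_ifs <;> simp_all

theorem perm_of_mem {j : ℕ} {x : X} (h : x ∈ D.setAt j) : D.recursion.perm j x ∈ D.setAt j :=
  cyc_apply_mem h

theorem perm_of_notMem {j : ℕ} {x : X} (h : x ∉ D.setAt j) : D.recursion.perm j x = x :=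
  cyc_apply_of_notMem h

theorem next_lt (hD : D.IsReduced) (j : ℕ) (hj : j < D.n + D.k) (x : X) :
    D.recursion.next j x < D.n + D.k := by
  have := hD.one_le_n
  have := hD.one_le_k
  rcases D.next_cases j x with h | h | h | h <;> omega

theorem next_zero (hD : D.IsReduced) (x : X) : D.recursion.next 0 x = 0 := by
  have := hD.one_le_n
  rcases D.next_cases 0 x with h | h | h | h
  · exact h.2
  · omega
  · omega
  · exact h.2.1

theorem perm_zero (x : X) : D.recursion.perm 0 x = x :=
  perm_of_notMem (by simp [setAt_zero])

theorem act_zero (hD : D.IsReduced) (w : List X) : D.recursion.act 0 w = w := by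
  induction w with
  | nil => rfl
  | cons a w ih => rw [WreathRecursion.act_cons, perm_zero, next_zero hD, ih]

theorem gen_zero (hD : D.IsReduced) : D.gen 0 = 1 :=
  treeAut_ext fun w => act_zero hD w

/-- The edges on which the states move along their cycle or towards the identity. -/
theorem eq_of_next_eq {j p : ℕ} {x : X} (hp : 1 ≤ p)
    (h : D.recursion.next j x = p) :
    (j = p + 1 ∧ x ∈ D.setAt j) ∨ (j = D.n ∧ D.IsLetter D.k x ∧ p = D.n + D.k - 1) ∨
      (D.n < j ∧ D.IsLetter (j - D.n) x ∧ j = p + 1) := by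
  rcases D.next_cases j x with h' | h' | h' | h'
  · exact Or.inl ⟨by omega, h'.1⟩
  · exact Or.inr (Or.inl ⟨h'.2.1, h'.2.2.1, by omega⟩)
  · exact Or.inr (Or.inr ⟨h'.2.1, h'.2.2.1, by omega⟩)
  · omega

theorem next_state (hD : D.IsReduced) {x : LeftWord X} (hx : x ∈ D.words) (m : ℕ) :
    D.recursion.next (D.state (m + 1)) (x m) = D.state m := by
  rw [mem_words_iff] at hx
  rcases Nat.lt_or_ge m D.n with hm | hm
  · rw [state_of_le hm, state_of_le hm.le, next_of_mem (hx.1 m hm), Nat.add_sub_cancel]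
  · obtain ⟨i, rfl⟩ := Nat.exists_eq_add_of_le hm
    have hl := hx.2 i
    rw [add_assoc, state_add, state_add]
    rcases succ_mod_cases hD.one_le_k i with ⟨h, h'⟩ | ⟨h, h'⟩
    · rw [h', next_of_isLetter (by omega) (by rwa [Nat.add_sub_cancel_left])]
      omega
    · rw [h', add_zero, next_n_of_isLetter hD (by rwa [h] at hl)]
      omega

/-- The words of the class form are permuted by the states. -/
def rotate (D : ClassForm X) (x : LeftWord X) : LeftWord X :=
  fun t => D.recursion.perm (D.state (t + 1)) (x t)

theorem rotate_mem (hD : D.IsReduced) {x : LeftWord X} (hx : x ∈ D.words) :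
    D.rotate x ∈ D.words := by
  rw [mem_words_iff] at hx ⊢
  constructor
  · intro t ht
    unfold rotate
    rw [state_of_le ht]
    exact perm_of_mem (hx.1 t ht)
  · intro i
    have hl := hx.2 i
    have : D.rotate x (D.n + i) = x (D.n + i) := by
      refine perm_of_notMem ?_
      rw [add_assoc, state_add]
      rcases succ_mod_cases hD.one_le_k i with ⟨h, h'⟩ | ⟨h, h'⟩
      · rw [h', setAt_eq_empty (by omega)]
        simp
      · rw [h', add_zero]
        exact hD.notMem_of_isLetter (by rwa [h] at hl)
    rwa [this]

/-- The run from `D.state m` passes through the states of smaller index and ends in the identity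
state after `m` letters, which leaves `w` untouched. -/
theorem act_state (hD : D.IsReduced) {x : LeftWord X} (hx : x ∈ D.words) (m : ℕ) (w : List X) :
    D.recursion.act (D.state m) (trunc x m ++ w) = trunc (D.rotate x) m ++ w := by
  induction m with
  | zero =>
    rw [state_of_le (Nat.zero_le _)]
    exact act_zero hD w
  | succ m ih =>
    rw [trunc, List.cons_append, WreathRecursion.act_cons, next_state hD hx, ih]
    rfl

/-- A path that leaves the state `1` through `S₁` at the end is the path of a word of the form. -/
theorem state_of_isPath (hD : D.IsReduced) {x y : LeftWord X} {q : ℕ → ℕ}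
    (hq : ∀ t, q t < D.n + D.k) (h : D.recursion.IsPath x y q) (h1 : q 1 = 1)
    (hx : x 0 ∈ D.setAt 1) : x ∈ D.words ∧ y = D.rotate x := by
  have hn := hD.one_le_n
  have hk := hD.one_le_k
  -- A nonzero state has exactly one possible predecessor: the next larger one, or `n` when the
  -- state is `n + k - 1`. Going backwards from `1`, the path thus climbs to `n` through the sets
  -- `S_j` and then circles through the letters of `z`.
  have key : ∀ t, q (t + 1) = D.state (t + 1) ∧ (t < D.n → x t ∈ D.setAt (t + 1)) ∧
      ∀ i, t = D.n + i → D.IsLetter (i % D.k + 1) (x t) := by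
    intro t
    induction t with
    | zero => exact ⟨by rw [state_of_le (by omega), zero_add, h1], fun _ => hx, by omega⟩
    | succ t ih =>
      have hnext := (h (t + 1)).1
      have hbd := hq (t + 1 + 1)
      rw [ih.1] at hnext
      rcases Nat.lt_or_ge (t + 1) D.n with ht | ht
      · rw [state_of_le ht.le] at hnext
        rw [state_of_le ht]
        rcases eq_of_next_eq (by omega) hnext with ⟨e, hm⟩ | ⟨e, -, hm⟩ | ⟨e, -, hm⟩
        · rw [e] at hm
          exact ⟨e, fun _ => hm, by omega⟩
        · omega
        · omega
      · obtain ⟨i, hi⟩ := Nat.exists_eq_add_of_le ht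
        rw [hi] at hnext hbd
        rw [state_add] at hnext
        rw [hi, add_assoc, state_add]
        have hkey : ∀ i', D.n + i = D.n + i' → i' = i := by omega
        rcases eq_of_next_eq (by omega) hnext with ⟨e, hm⟩ | ⟨e, hm, e'⟩ | ⟨e, hm, e'⟩
        · have := (le_n_of_mem_setAt hm).2
          omega
        · have h3 : i % D.k + 1 = D.k := by omega
          rcases succ_mod_cases hk i with ⟨h4, h5⟩ | ⟨h4, h5⟩
          · omega
          · refine ⟨by rw [← add_assoc, h5, e, add_zero], by omega, fun i' hi' => ?_⟩
            rwa [hkey i' hi', h4]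
        · have e2 : q (D.n + i + 1) - D.n = i % D.k + 1 := by omega
          rcases succ_mod_cases hk i with ⟨h4, h5⟩ | ⟨h4, h5⟩
          · refine ⟨by rw [← add_assoc, h5, e']; rfl, by omega, fun i' hi' => ?_⟩
            rwa [hkey i' hi', ← e2]
          · omega
  refine ⟨mem_words_iff.2 ⟨fun t ht => (key t).2.1 ht, fun i => (key _).2.2 i rfl⟩, ?_⟩
  funext t
  rw [← (h t).2, (key t).1]
  rfl

/-! ### Asymptotically equivalent words lie in one fibre -/

section Fibres

variable {K : Type v} {f : LeftWord X → K}

/-- Appending suitable letters drives the last state down to `1` and then out through `S_1`. The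
extended words lie in one fibre, and shifting removes the added letters. -/
theorem eq_of_isPath_of_pos (hD : D.IsReduced) (hne : ∀ j, 1 ≤ j → j ≤ D.n → (D.setAt j).Nonempty)
    (hsh : ∀ x y, f x = f y → f (shift x) = f (shift y))
    (hw : ∀ x ∈ D.words, ∀ y ∈ D.words, f x = f y) {x y : LeftWord X} {q : ℕ → ℕ}
    (hq : ∀ t, q t < D.n + D.k) (h : D.recursion.IsPath x y q) (h0 : 1 ≤ q 0) : f x = f y := by
  obtain ⟨j, hj⟩ := Nat.exists_eq_add_of_le' h0
  induction j generalizing x y q with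
  | zero =>
    obtain ⟨a, ha⟩ := hne 1 le_rfl hD.one_le_n
    have hw' := state_of_isPath hD (fun t => ?_) (h.append a) hj ha
    · exact hsh _ _ (hw _ hw'.1 _ (hw'.2 ▸ rotate_mem hD hw'.1))
    · cases t with
      | zero => exact next_lt hD _ (hq 0) _
      | succ t => exact hq t
  | succ j ih =>
    obtain ⟨a, ha⟩ : ∃ a, D.recursion.next (q 0) a = j + 1 := by
      rcases Nat.lt_or_ge D.n (q 0) with hlt | hge
      · obtain ⟨a, ha⟩ := exists_isLetter (D := D) (j := q 0 - D.n) (by omega)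
          (by have := hq 0; omega)
        exact ⟨a, by rw [next_of_isLetter hlt ha, hj]; rfl⟩
      · obtain ⟨a, ha⟩ := hne _ h0 hge
        exact ⟨a, by rw [next_of_mem ha, hj]; rfl⟩
    refine hsh _ _ (ih (fun t => ?_) (h.append a) ?_ ha)
    · cases t with
      | zero => exact next_lt hD _ (hq 0) _
      | succ t => exact hq t
    · change 1 ≤ D.recursion.next (q 0) a
      omega

/-- Common last letters read into the identity state are deleted. What remains is a path ending in a
nonzero state or one just leaving through `S_1`; a path that stays at `0` forces equal words. -/
theorem eq_of_isPath (hD : D.IsReduced) (hne : ∀ j, 1 ≤ j → j ≤ D.n → (D.setAt j).Nonempty)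
    (happ : ∀ a x y, f x = f y → f (appendLetter a x) = f (appendLetter a y))
    (hsh : ∀ x y, f x = f y → f (shift x) = f (shift y))
    (hw : ∀ x ∈ D.words, ∀ y ∈ D.words, f x = f y) {x y : LeftWord X} {q : ℕ → ℕ}
    (hq : ∀ t, q t < D.n + D.k) (h : D.recursion.IsPath x y q) : f x = f y := by
  by_cases hz : ∃ t, q t ≠ 0
  · obtain ⟨t, ht⟩ := hz
    induction t generalizing x y q with
    | zero => exact eq_of_isPath_of_pos hD hne hsh hw hq h (by omega)
    | succ t ih =>
      by_cases h0 : q 0 = 0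
      · by_cases hx : x 0 ∈ D.setAt (q 1)
        · have h1 := (h 0).1
          have h2 := (le_n_of_mem_setAt hx).1
          rw [zero_add, next_of_mem hx] at h1
          have h3 : q 1 = 1 := by omega
          rw [h3] at hx
          have hw' := state_of_isPath hD hq h h3 hx
          exact hw _ hw'.1 _ (hw'.2 ▸ rotate_mem hD hw'.1)
        · have hxy : x 0 = y 0 := by rw [← (h 0).2, zero_add, perm_of_notMem hx]
          rw [← appendLetter_shift x, ← appendLetter_shift y, hxy]
          exact happ _ _ _ (ih (fun t => hq (t + 1)) h.shift ht)
      · exact eq_of_isPath_of_pos hD hne hsh hw hq h (by omega)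
  · have hxy : x = y := by
      funext t
      rw [← (h t).2, not_not.1 (not_exists.1 hz (t + 1)), perm_zero]
    rw [hxy]

/-- One step of a state of one of the forms in `𝒟`, in either direction. -/
def stepRel (𝒟 : Set (ClassForm X)) (u v : List X) : Prop :=
  u = v ∨ ∃ D ∈ 𝒟, ∃ j < D.n + D.k, D.recursion.act j u = v ∨ D.recursion.act j v = u

theorem length_act (j : ℕ) (w : List X) : (D.recursion.act j w).length = w.length :=
  length_apply (D.gen j) w

/-- The form and the direction of the step may vary with `m`. A relation that holds at one level
holds at all lower ones, so if each of the finitely many choices failed somewhere, all would fail at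
a common large level. -/
theorem eq_of_forall_stepRel {𝒟 : Set (ClassForm X)} (hfin : 𝒟.Finite)
    (hred : ∀ D ∈ 𝒟, D.IsReduced)
    (hne : ∀ D ∈ 𝒟, ∀ j, 1 ≤ j → j ≤ D.n → (D.setAt j).Nonempty)
    (happ : ∀ a x y, f x = f y → f (appendLetter a x) = f (appendLetter a y))
    (hsh : ∀ x y, f x = f y → f (shift x) = f (shift y))
    (hw : ∀ D ∈ 𝒟, ∀ x ∈ D.words, ∀ y ∈ D.words, f x = f y) {x y : LeftWord X}
    (h : ∀ m, stepRel 𝒟 (trunc x m) (trunc y m)) : f x = f y := by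
  by_contra hne'
  let P : ClassForm X → LeftWord X → LeftWord X → ℕ → Prop := fun D x y m =>
    ∃ j < D.n + D.k, D.recursion.act j (trunc x m) = trunc y m
  have hanti : ∀ D ∈ 𝒟, ∀ x y m m', m ≤ m' → P D x y m' → P D x y m := by
    intro D hD x y m m' hm
    induction m', hm using Nat.le_induction with
    | base => exact id
    | succ m' _ ih =>
      rintro ⟨j, hj, hjm⟩
      exact ih ⟨_, next_lt (hred D hD) j hj (x m'), (List.cons.inj hjm).2⟩
  have hP : ∀ D ∈ 𝒟, ∀ x y, f x ≠ f y → ∃ m, ¬ P D x y m := by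
    intro D hD x y hxy
    by_contra hall
    obtain ⟨q, hq, hpath⟩ := D.recursion.exists_isPath (next_lt (hred D hD))
      (not_exists_not.1 hall)
    exact hxy (eq_of_isPath (hred D hD) (hne D hD) happ hsh (hw D hD) hq hpath)
  have hxy : x ≠ y := fun e => hne' (e ▸ rfl)
  obtain ⟨t, ht⟩ := Function.ne_iff.1 hxy
  choose! m₁ h₁ using fun D hD => hP D hD x y hne'
  choose! m₂ h₂ using fun D hD => hP D hD y x (Ne.symm hne')
  obtain ⟨M₁, hM₁⟩ := (hfin.image m₁).bddAbove
  obtain ⟨M₂, hM₂⟩ := (hfin.image m₂).bddAbove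
  rcases h (M₁ + M₂ + t + 1) with h' | ⟨D, hD, j, hj, h' | h'⟩
  · exact ht (trunc_eq_trunc_iff.1 h' t (by omega))
  · have := hM₁ ⟨D, hD, rfl⟩
    exact h₁ D hD (hanti D hD _ _ _ _ (by omega) ⟨j, hj, h'⟩)
  · have := hM₂ ⟨D, hD, rfl⟩
    exact h₂ D hD (hanti D hD _ _ _ _ (by omega) ⟨j, hj, h'⟩)

/-- The chain length is a word length of `g` in the generators, hence independent of the word acted
on. -/
theorem exists_stepChain {𝒟 : Set (ClassForm X)} {g : treeAut X}
    (hg : g ∈ Subgroup.closure {g | ∃ D ∈ 𝒟, ∃ j < D.n + D.k, g = D.gen j}) :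
    ∃ L, ∀ w, stepChain (stepRel 𝒟) L w (g.1 w) := by
  induction hg using Subgroup.closure_induction_left with
  | one => exact ⟨0, fun w => rfl⟩
  | mul_left a ha g _ ih =>
    obtain ⟨D, hD, j, hj, rfl⟩ := ha
    obtain ⟨L, hL⟩ := ih
    exact ⟨L + 1, fun w => (hL w).trans ⟨_, Or.inr ⟨D, hD, j, hj, Or.inl rfl⟩, rfl⟩⟩
  | inv_mul_cancel a ha g _ ih =>
    obtain ⟨D, hD, j, hj, rfl⟩ := ha
    obtain ⟨L, hL⟩ := ih
    exact ⟨L + 1, fun w => (hL w).trans ⟨_, Or.inr ⟨D, hD, j, hj, Or.inr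
      (apply_inv_apply' (D.gen j) (g.1 w))⟩, rfl⟩⟩

theorem eq_of_asympEquiv [Finite X] {𝒟 : Set (ClassForm X)} (hfin : 𝒟.Finite)
    (hred : ∀ D ∈ 𝒟, D.IsReduced)
    (hne : ∀ D ∈ 𝒟, ∀ j, 1 ≤ j → j ≤ D.n → (D.setAt j).Nonempty)
    (happ : ∀ a x y, f x = f y → f (appendLetter a x) = f (appendLetter a y))
    (hsh : ∀ x y, f x = f y → f (shift x) = f (shift y))
    (hw : ∀ D ∈ 𝒟, ∀ x ∈ D.words, ∀ y ∈ D.words, f x = f y) {x y : LeftWord X}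
    (h : AsympEquiv (Subgroup.closure {g | ∃ D ∈ 𝒟, ∃ j < D.n + D.k, g = D.gen j}) x y) :
    f x = f y := by
  obtain ⟨g, hg, hgf, hgxy⟩ := h
  have hex : ∀ a ∈ Set.range g, ∃ L, ∀ w, stepChain (stepRel 𝒟) L w (a.1 w) := by
    rintro _ ⟨m, rfl⟩
    exact exists_stepChain (hg m)
  choose! L hL using hex
  obtain ⟨M, hM⟩ := (hgf.image L).bddAbove
  refine eq_of_forall_stepChain (r := stepRel 𝒟) (L := M) ?_ ?_
    (fun _ _ => eq_of_forall_stepRel hfin hred hne happ hsh hw) fun m => ?_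
  · rintro u v (rfl | ⟨D, hD, j, hj, rfl | rfl⟩)
    · rfl
    · rw [length_act]
    · rw [length_act]
  · rintro a b u v (e | ⟨D, hD, j, hj, e | e⟩)
    · exact Or.inl (List.cons.inj e).2
    · exact Or.inr ⟨D, hD, _, next_lt (hred D hD) j hj _, Or.inl (List.cons.inj e).2⟩
    · exact Or.inr ⟨D, hD, _, next_lt (hred D hD) j hj _, Or.inr (List.cons.inj e).2⟩
  · rw [← hgxy m]
    exact (hL _ ⟨m, rfl⟩ _).mono (r := stepRel 𝒟) (fun _ => Or.inl rfl) (hM ⟨_, ⟨m, rfl⟩, rfl⟩)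

end Fibres

end Recursion

end ClassForm

/-! ### Words in one fibre are asymptotically equivalent -/

section RigidEquiv

variable {X : Type u} {G : Subgroup (treeAut X)}

/-- Asymptotic equivalence by elements whose sections at the truncations are trivial. -/
def RigidEquiv (G : Subgroup (treeAut X)) (x y : LeftWord X) : Prop :=
  ∃ g : ℕ → treeAut X, (∀ m, g m ∈ G) ∧ (Set.range g).Finite ∧
    ∀ m w, (g m).1 (trunc x m ++ w) = trunc y m ++ w

theorem RigidEquiv.refl (x : LeftWord X) : RigidEquiv G x x :=
  ⟨fun _ => 1, fun _ => G.one_mem, Set.finite_range_const, fun _ _ => rfl⟩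

theorem RigidEquiv.trans {x y z : LeftWord X} (h : RigidEquiv G x y) (h' : RigidEquiv G y z) :
    RigidEquiv G x z := by
  obtain ⟨g, hg, hf, h⟩ := h
  obtain ⟨g', hg', hf', h'⟩ := h'
  refine ⟨fun m => g' m * g m, fun m => G.mul_mem (hg' m) (hg m), ?_, fun m w => ?_⟩
  · refine (Set.Finite.image2 (fun a b => a * b) hf' hf).subset ?_
    rintro _ ⟨m, rfl⟩
    exact ⟨g' m, ⟨m, rfl⟩, g m, ⟨m, rfl⟩, rfl⟩
  · rw [mul_apply', h, h']

/-- Trivial sections are needed here: the element for the truncation without the new letter already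
fixes that letter. The index `m - 1` at `m = 0` is harmless, as `g 0` acts trivially. -/
theorem RigidEquiv.append {x y : LeftWord X} (h : RigidEquiv G x y) (a : X) :
    RigidEquiv G (appendLetter a x) (appendLetter a y) := by
  obtain ⟨g, hg, hf, h⟩ := h
  refine ⟨fun m => g (m - 1), fun m => hg _, hf.subset ?_, fun m w => ?_⟩
  · rintro _ ⟨m, rfl⟩
    exact ⟨m - 1, rfl⟩
  · cases m with
    | zero => exact h 0 w
    | succ m =>
      rw [trunc_appendLetter, trunc_appendLetter, List.append_assoc, List.append_assoc]
      exact h m _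

theorem RigidEquiv.asympEquiv {x y : LeftWord X} (h : RigidEquiv G x y) : AsympEquiv G x y := by
  obtain ⟨g, hg, hf, h⟩ := h
  refine ⟨g, hg, hf, fun m => ?_⟩
  simpa using h m []

end RigidEquiv

namespace ClassForm

variable {X : Type u}

theorem appendLetter_mem_words {s : Finset X} {S : List (Finset X)} {z : List X} {a : X}
    {x : LeftWord X} :
    appendLetter a x ∈ (⟨s :: S, z⟩ : ClassForm X).words ↔
      a ∈ s ∧ x ∈ (⟨S, z⟩ : ClassForm X).words := by
  have hn : (⟨s :: S, z⟩ : ClassForm X).n = (⟨S, z⟩ : ClassForm X).n + 1 := rfl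
  rw [mem_words_iff, mem_words_iff, ← and_assoc]
  refine and_congr ⟨fun h => ⟨h 0 (by omega), fun t ht => ?_⟩, ?_⟩ (forall_congr' fun i => ?_)
  · exact h (t + 1) (by omega)
  · rintro ⟨h0, h⟩ t ht
    cases t with
    | zero => exact h0
    | succ t => exact h t (by omega)
  · rw [hn, Nat.add_right_comm]
    rfl

theorem IsReduced.tail {s : Finset X} {S : List (Finset X)} {z : List X}
    (h : (⟨s :: S, z⟩ : ClassForm X).IsReduced) (hS : S ≠ []) :
    (⟨S, z⟩ : ClassForm X).IsReduced where
  S_ne_nil := hS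
  z_ne_nil := h.z_ne_nil
  primitive := h.primitive
  last_notMem := by
    have := h.last_notMem
    rwa [List.getLast_cons hS] at this

variable {K : Type v} {f : LeftWord X → K}

/-- Deleting the last letter of a fibre deletes `S_1`. This permits induction on `n` although the
shifted point need not be critical. -/
theorem preimage_tail (happ : ∀ a x y, f x = f y → f (appendLetter a x) = f (appendLetter a y))
    (hsh : ∀ x y, f x = f y → f (shift x) = f (shift y))
    {s : Finset X} {S : List (Finset X)} {z : List X} {x : LeftWord X}
    (h : f ⁻¹' {f x} = (⟨s :: S, z⟩ : ClassForm X).words) :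
    f ⁻¹' {f (shift x)} = (⟨S, z⟩ : ClassForm X).words := by
  have hx : x ∈ (⟨s :: S, z⟩ : ClassForm X).words := h ▸ rfl
  rw [← appendLetter_shift x, appendLetter_mem_words] at hx
  ext y
  constructor
  · intro hy
    have h1 := happ (x 0) _ _ (Set.mem_singleton_iff.1 hy)
    rw [appendLetter_shift] at h1
    have h2 : appendLetter (x 0) y ∈ f ⁻¹' {f x} := h1
    rw [h, appendLetter_mem_words] at h2
    exact h2.2
  · intro hy
    have h1 : appendLetter (x 0) y ∈ f ⁻¹' {f x} := by
      rw [h, appendLetter_mem_words]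
      exact ⟨hx.1, hy⟩
    exact hsh _ _ (Set.mem_singleton_iff.1 h1)

variable [LinearOrder X] {G : Subgroup (treeAut X)}

theorem rigidEquiv_rotate {D : ClassForm X} (hD : D.IsReduced)
    (hG : ∀ j < D.n + D.k, D.gen j ∈ G) {x : LeftWord X} (hx : x ∈ D.words) :
    RigidEquiv G x (D.rotate x) := by
  refine ⟨fun m => D.gen (D.state m), fun m => hG _ (state_lt hD m), ?_,
    fun m w => act_state hD hx m w⟩
  refine ((Set.finite_lt_nat (D.n + D.k)).image D.gen).subset ?_
  rintro _ ⟨m, rfl⟩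
  exact ⟨_, state_lt hD m, rfl⟩

theorem exists_rigidEquiv_cyc_pow {D : ClassForm X} (hD : D.IsReduced)
    (hG : ∀ j < D.n + D.k, D.gen j ∈ G) {x : LeftWord X} (hx : x ∈ D.words) (e : ℕ) :
    ∃ y ∈ D.words, y 0 = (cyc (D.setAt 1) ^ e) (x 0) ∧ RigidEquiv G x y := by
  induction e with
  | zero => exact ⟨x, hx, rfl, RigidEquiv.refl x⟩
  | succ e ih =>
    obtain ⟨y, hy, hy0, hxy⟩ := ih
    refine ⟨D.rotate y, rotate_mem hD hy, ?_, hxy.trans (rigidEquiv_rotate hD hG hy)⟩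
    rw [pow_succ', Equiv.Perm.mul_apply, ← hy0, rotate, zero_add, state_of_le hD.one_le_n]
    rfl

/-- Powers of the rotation make the last letters agree, as `cyc` is transitive on `S_1`; the other
letters may change but the word stays in the fibre. Then the last letter is deleted. Generators are
needed only where last letters differ, that is, at critical points. -/
theorem rigidEquiv_of_mem_words
    (happ : ∀ a x y, f x = f y → f (appendLetter a x) = f (appendLetter a y))
    (hsh : ∀ x y, f x = f y → f (shift x) = f (shift y))
    (hG : ∀ x y, f x = f y → x 0 ≠ y 0 → ∀ D : ClassForm X, IsFormOf f (f x) D →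
      ∀ j < D.n + D.k, D.gen j ∈ G)
    {D : ClassForm X} {x y : LeftWord X} (hD : IsFormOf f (f x) D) (hy : y ∈ D.words) :
    RigidEquiv G x y := by
  obtain ⟨S, z⟩ := D
  induction S generalizing x y with
  | nil => exact absurd rfl hD.1.S_ne_nil
  | cons s S ih =>
    obtain ⟨hred, hfib⟩ := hD
    have hx : x ∈ (⟨s :: S, z⟩ : ClassForm X).words := hfib ▸ rfl
    have hmem : ∀ w ∈ (⟨s :: S, z⟩ : ClassForm X).words, f w = f x := by
      rw [← hfib]
      exact fun w hw => hw
    have h0 : ∀ w ∈ (⟨s :: S, z⟩ : ClassForm X).words, w 0 ∈ s ∧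
        shift w ∈ (⟨S, z⟩ : ClassForm X).words := fun w hw => by
      rwa [← appendLetter_shift w, appendLetter_mem_words] at hw
    obtain ⟨x', hx', hx0, hxx'⟩ : ∃ x' ∈ (⟨s :: S, z⟩ : ClassForm X).words,
        x' 0 = y 0 ∧ RigidEquiv G x x' := by
      by_cases hxy : x 0 = y 0
      · exact ⟨x, hx, hxy, RigidEquiv.refl x⟩
      · obtain ⟨e, he⟩ := exists_cyc_pow_apply (h0 x hx).1 (h0 y hy).1
        obtain ⟨x', hx', hx0, hxx'⟩ := exists_rigidEquiv_cyc_pow hred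
          (hG x y (hmem y hy).symm hxy _ ⟨hred, hfib⟩) hx e
        exact ⟨x', hx', hx0.trans he, hxx'⟩
    refine hxx'.trans ?_
    suffices RigidEquiv G (shift x') (shift y) by
      have := this.append (y 0)
      rwa [appendLetter_shift, appendLetter_shift_of_eq hx0] at this
    by_cases hS : S = []
    · subst hS
      have h1 := (mem_words_iff.1 (h0 x' hx').2).2
      have h2 := (mem_words_iff.1 (h0 y hy).2).2
      have : shift x' = shift y := funext fun i => by
        have h3 := (h1 i).eq (h2 i)
        change shift x' (0 + i) = shift y (0 + i) at h3
        rwa [zero_add] at h3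
      rw [this]
      exact RigidEquiv.refl _
    · rw [← hmem x' hx'] at hfib
      exact ih ⟨hred.tail hS, preimage_tail happ hsh hfib⟩ (h0 y hy).2

theorem rigidEquiv_of_eq
    (happ : ∀ a x y, f x = f y → f (appendLetter a x) = f (appendLetter a y))
    (hsh : ∀ x y, f x = f y → f (shift x) = f (shift y))
    (hform : ∀ x y, f x = f y → x 0 ≠ y 0 → ∃ D : ClassForm X, IsFormOf f (f x) D)
    (hG : ∀ x y, f x = f y → x 0 ≠ y 0 → ∀ D : ClassForm X, IsFormOf f (f x) D →
      ∀ j < D.n + D.k, D.gen j ∈ G)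
    {x y : LeftWord X} (hxy : f x = f y) : RigidEquiv G x y := by
  by_cases h : ∃ t, x t ≠ y t
  · obtain ⟨t, ht⟩ := h
    have key : ∀ x y, f x = f y → x 0 ≠ y 0 → RigidEquiv G x y := fun x y hxy h => by
      obtain ⟨D, hD⟩ := hform x y hxy h
      exact rigidEquiv_of_mem_words happ hsh hG hD (hD.2 ▸ hxy.symm)
    induction t generalizing x y with
    | zero => exact key x y hxy ht
    | succ t ih =>
      by_cases h0 : x 0 = y 0
      · have := (ih (hsh _ _ hxy) ht).append (y 0)
        rwa [appendLetter_shift, appendLetter_shift_of_eq h0] at this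
      · exact key x y hxy h0
  · have : x = y := funext fun t => not_not.1 (not_exists.1 h t)
    rw [this]
    exact RigidEquiv.refl y

end ClassForm

/-! ### Normal forms of fibres -/

namespace ClassForm

variable {X : Type u}

theorem getElem?_flatten_replicate {α : Type*} (v : List α) (m i : ℕ) (hi : i < m * v.length) :
    (List.replicate m v).flatten[i]? = v[i % v.length]? := by
  induction m generalizing i with
  | zero => simp at hi
  | succ m ih =>
    rw [List.replicate_succ, List.flatten_cons]
    rcases Nat.lt_or_ge i v.length with h | h
    · rw [List.getElem?_append_left h, Nat.mod_eq_of_lt h]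
    · rw [List.getElem?_append_right h, ih, ← Nat.mod_eq_sub_mod h]
      rw [Nat.succ_mul] at hi
      omega

theorem add_mul_eq_of_add_eq {α : Type*} {u : ℕ → α} {N k : ℕ} (h : ∀ t ≥ N, u (t + k) = u t)
    (j : ℕ) {t : ℕ} (ht : N ≤ t) : u (t + j * k) = u t := by
  induction j with
  | zero => simp
  | succ j ih => rw [Nat.succ_mul, ← add_assoc, h _ (by omega), ih]

/-- A word with a proper divisor of its length as a period is a proper power. -/
theorem exists_eq_flatten_replicate {α : Type*} {z : List α} {u : ℕ → α} {g : ℕ} (hg : 0 < g)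
    (hgk : g ∣ z.length) (hlt : g < z.length) (hz : ∀ i < z.length, z[i]? = some (u i))
    (hper : ∀ t, u (t + g) = u t) :
    ∃ (v : List α) (m : ℕ), 1 < m ∧ z = (List.replicate m v).flatten := by
  obtain ⟨m, hm⟩ := hgk
  have hl : (z.take g).length = g := by simp [hlt.le]
  refine ⟨z.take g, m, ?_, List.ext_getElem? fun i => ?_⟩
  · by_contra h
    have := Nat.mul_le_mul_left g (not_lt.1 h)
    omega
  · rcases Nat.lt_or_ge i z.length with hi | hi
    · have hmod := Nat.mod_lt i hg
      rw [getElem?_flatten_replicate _ _ _ (by rw [hl, mul_comm, ← hm]; exact hi), hl,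
        List.getElem?_take_of_lt hmod, hz i hi, hz _ (by omega)]
      have := add_mul_eq_of_add_eq (u := u) (N := 0) (fun t _ => hper t) (i / g)
        (Nat.zero_le (i % g))
      rw [← this, Nat.mod_add_div']
    · rw [List.getElem?_eq_none hi, List.getElem?_eq_none]
      simp only [List.length_flatten, List.map_replicate, List.sum_replicate, smul_eq_mul, hl]
      rw [mul_comm, ← hm]
      exact hi

/-! ### Uniqueness of the normal form -/

section Uniqueness

variable {D D' : ClassForm X} {x : LeftWord X}

theorem apply_add_k (hx : x ∈ D.words) : ∀ t ≥ D.n, x (t + D.k) = x t := by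
  intro t ht
  obtain ⟨i, rfl⟩ := Nat.exists_eq_add_of_le ht
  have h1 := (mem_words_iff.1 hx).2 i
  have h2 := (mem_words_iff.1 hx).2 (i + D.k)
  rw [Nat.add_mod_right] at h2
  rw [add_assoc]
  exact h2.eq h1

theorem getElem?_z (hx : x ∈ D.words) {i : ℕ} (hi : i < D.k) : D.z[i]? = some (x (D.n + i)) := by
  have h := hx.2 i
  rwa [Nat.mod_eq_of_lt hi] at h

/-- If `D'` had the larger `n`, its place `n' - 1` would lie in the periodic part of `D`. Moving by
the common period `k' * k` would then carry it to an occurrence of `z'_{k'}`, against `z'_{k'} ∉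
S'_{n'}`. -/
theorem n_le_of_mem_words (hD' : D'.IsReduced) (hD : D.IsReduced) (hx : x ∈ D.words)
    (hx' : x ∈ D'.words) : D'.n ≤ D.n := by
  by_contra h
  have hk := hD.one_le_k
  have hk' := hD'.one_le_k
  have h1 := (mem_words_iff.1 hx').1 (D'.n - 1) (by omega)
  have h2 := add_mul_eq_of_add_eq (apply_add_k hx) D'.k (t := D'.n - 1) (by omega)
  have hpos : 1 ≤ D'.k * D.k := Nat.mul_pos hk' hk
  have h3 := (mem_words_iff.1 hx').2 (D'.k * D.k - 1)
  have h4 : (D'.k * D.k - 1) % D'.k + 1 = D'.k := by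
    rcases succ_mod_cases hk' (D'.k * D.k - 1) with ⟨h5, h6⟩ | h5
    · rw [Nat.sub_add_cancel hpos, Nat.mul_mod_right] at h6
      omega
    · exact h5.1
  rw [h4, show D'.n + (D'.k * D.k - 1) = D'.n - 1 + D'.k * D.k by omega, h2] at h3
  rw [show D'.n - 1 + 1 = D'.n by omega] at h1
  exact hD'.notMem_of_isLetter h3 h1

theorem k_dvd_of_mem_words (hD : D.IsReduced) (hn : D.n = D'.n) (hx : x ∈ D.words)
    (hx' : x ∈ D'.words) : D.k ∣ D'.k := by
  by_contra h
  have hk := hD.one_le_k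
  have hlt : D'.k.gcd D.k < D.k := by
    refine lt_of_le_of_ne (Nat.gcd_le_right _ hk) fun e => h ?_
    rw [← e]
    exact Nat.gcd_dvd_left _ _
  -- Bézout: both lengths are periods of the tail, hence so is their gcd, and a gcd below `D.k`
  -- makes `z` a proper power.
  obtain ⟨m, -, hm⟩ := Nat.exists_mul_mod_eq_gcd hlt
  obtain ⟨v, r, hr, hz⟩ := exists_eq_flatten_replicate (z := D.z) (u := fun i => x (D.n + i))
    (Nat.gcd_pos_of_pos_right D'.k hk) (Nat.gcd_dvd_right _ _) hlt
    (fun i hi => getElem?_z hx hi) (fun t => by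
      have h1 := add_mul_eq_of_add_eq (apply_add_k hx) (D'.k * m / D.k)
        (t := D.n + (t + D'.k.gcd D.k)) (by omega)
      have h2 := add_mul_eq_of_add_eq (apply_add_k hx') m (t := D.n + t) (by omega)
      rw [← h1, ← h2]
      congr 1
      have := Nat.mod_add_div' (D'.k * m) D.k
      rw [hm, mul_comm D'.k m] at this
      rw [mul_comm D'.k m]
      omega)
  exact hD.primitive v r hr hz

/-- Letters before place `n` vary independently, so the set of words determines each `S_j`. -/
theorem exists_mem_words_apply_eq (hx : x ∈ D.words) {t : ℕ} (ht : t < D.n) {a : X} :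
    a ∈ D.setAt (t + 1) ↔ ∃ y ∈ D.words, y t = a := by
  constructor
  · intro ha
    refine ⟨Function.update x t a, ?_, Function.update_self _ _ _⟩
    rw [mem_words_iff] at hx ⊢
    refine ⟨fun t' ht' => ?_, fun i => ?_⟩
    · rcases eq_or_ne t' t with rfl | h
      · rwa [Function.update_self]
      · rw [Function.update_of_ne h]
        exact hx.1 t' ht'
    · rw [Function.update_of_ne (by omega)]
      exact hx.2 i
  · rintro ⟨y, hy, rfl⟩
    exact (mem_words_iff.1 hy).1 t ht

theorem eq_of_words_eq (hD : D.IsReduced) (hD' : D'.IsReduced) (hx : x ∈ D.words)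
    (h : D.words = D'.words) : D = D' := by
  have hx' : x ∈ D'.words := h ▸ hx
  have hn : D.n = D'.n :=
    le_antisymm (n_le_of_mem_words hD hD' hx' hx) (n_le_of_mem_words hD' hD hx hx')
  have hk : D.k = D'.k :=
    Nat.dvd_antisymm (k_dvd_of_mem_words hD hn hx hx') (k_dvd_of_mem_words hD' hn.symm hx' hx)
  have hS : D.S = D'.S := by
    refine List.ext_getElem hn fun i h1 h2 => Finset.ext fun a => ?_
    rw [← mem_setAt_succ h1, ← mem_setAt_succ h2, exists_mem_words_apply_eq hx h1,
      exists_mem_words_apply_eq hx' h2, h]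
  have hz : D.z = D'.z := by
    refine List.ext_getElem? fun i => ?_
    rcases Nat.lt_or_ge i D.k with hi | hi
    · rw [getElem?_z hx hi, getElem?_z hx' (hk ▸ hi), hn]
    · rw [List.getElem?_eq_none hi, List.getElem?_eq_none (show D'.k ≤ i by omega)]
  cases D
  cases D'
  subst hS
  subst hz
  rfl

theorem setAt_nonempty (hx : x ∈ D.words) {j : ℕ} (h1 : 1 ≤ j) (h2 : j ≤ D.n) :
    (D.setAt j).Nonempty := by
  obtain ⟨t, rfl⟩ := Nat.exists_eq_add_of_le' h1
  exact ⟨_, (mem_words_iff.1 hx).1 t h2⟩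

end Uniqueness

/-! ### Existence of the normal form -/

section Existence

variable {K : Type v} {f : LeftWord X → K}

/-- The word with the letters of `y` at the first `i` places and those of `v` beyond. -/
def splice (i : ℕ) (y v : LeftWord X) : LeftWord X := fun t => if t < i then y t else v t

theorem splice_of_lt {i t : ℕ} (y v : LeftWord X) (h : t < i) : splice i y v t = y t := if_pos h

theorem splice_of_ge {i t : ℕ} (y v : LeftWord X) (h : i ≤ t) : splice i y v t = v t :=
  if_neg (not_lt.2 h)

theorem apply_shift_iterate_eq (hsh : ∀ x y, f x = f y → f (shift x) = f (shift y))
    {x y : LeftWord X} (h : f x = f y) (i : ℕ) : f (shift^[i] x) = f (shift^[i] y) := by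
  induction i with
  | zero => exact h
  | succ i ih =>
    rw [Function.iterate_succ_apply', Function.iterate_succ_apply']
    exact hsh _ _ ih

theorem apply_splice (happ : ∀ a x y, f x = f y → f (appendLetter a x) = f (appendLetter a y))
    {i : ℕ} {y v : LeftWord X} (h : f (shift^[i] y) = f (shift^[i] v)) :
    f (splice i y v) = f y := by
  induction i generalizing y v with
  | zero => exact h.symm
  | succ i ih =>
    have h1 := happ (y 0) _ _ (ih h)
    rw [appendLetter_shift] at h1
    rw [← h1]
    congr 1
    funext t
    cases t with
    | zero => rfl
    | succ t => simp [splice, shift, appendLetter]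

variable (happ : ∀ a x y, f x = f y → f (appendLetter a x) = f (appendLetter a y))
  (hsh : ∀ x y, f x = f y → f (shift x) = f (shift y))

include happ hsh

theorem apply_splice_of_eq {i : ℕ} {y v : LeftWord X} (h : f y = f v) : f (splice i y v) = f y :=
  apply_splice happ (apply_shift_iterate_eq hsh h i)

/-- Splicing `y` and `x` at the different places where they disagree gives different words of the
fibre, so a finite fibre allows only finitely many disagreements. -/
theorem exists_forall_ge_eq {x : LeftWord X} (hfin : (f ⁻¹' {f x}).Finite) :
    ∃ N, ∀ y, f y = f x → ∀ t ≥ N, y t = x t := by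
  have h1 : ∀ y ∈ f ⁻¹' {f x}, ∃ N, ∀ t ≥ N, y t = x t := by
    intro y hy
    have hI : {i | y i ≠ x i}.Finite := by
      refine Set.Finite.of_finite_image (f := fun i => splice i y x)
        (hfin.subset ?_) ?_
      · rintro _ ⟨i, -, rfl⟩
        exact (apply_splice_of_eq happ hsh hy).trans hy
      · have key : ∀ i j, y i ≠ x i → i < j → splice i y x ≠ splice j y x := by
          intro i j hi hij e
          have := congrFun e i
          rw [splice_of_ge _ _ le_rfl, splice_of_lt _ _ hij] at this
          exact hi this.symm
        intro i hi j hj e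
        rcases lt_trichotomy i j with h | h | h
        · exact absurd e (key i j hi h)
        · exact h
        · exact absurd e.symm (key j i hj h)
    obtain ⟨N, hN⟩ := hI.bddAbove
    refine ⟨N + 1, fun t ht => ?_⟩
    by_contra hne
    have := hN hne
    omega
  choose! N hN using h1
  obtain ⟨M, hM⟩ := (hfin.image N).bddAbove
  exact ⟨M, fun y hy t ht => hN y hy t (le_trans (hM ⟨y, hy, rfl⟩) ht)⟩

/-- The product structure of a fibre: starting from `x`, the letters of `y` are brought in one at a
time, each borrowed from some word of the fibre having it at that place. -/
theorem apply_eq_of_forall_exists {x y : LeftWord X} {n : ℕ}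
    (h1 : ∀ t < n, ∃ v, f v = f x ∧ v t = y t) (h2 : ∀ t ≥ n, y t = x t) : f y = f x := by
  have key : ∀ i ≤ n, f (splice i y x) = f x := by
    intro i
    induction i with
    | zero => exact fun _ => congrArg f (funext fun t => splice_of_ge _ _ (Nat.zero_le t))
    | succ i ih =>
      intro hi
      obtain ⟨v, hv, hvi⟩ := h1 i hi
      have hu := ih (by omega)
      have hw := (apply_splice_of_eq happ hsh (i := i + 1) hv).trans hv
      have := (apply_splice_of_eq happ hsh (i := i) (hu.trans hw.symm)).trans hu
      rw [← this]
      congr 1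
      funext t
      rcases lt_trichotomy t i with h | rfl | h
      · rw [splice_of_lt _ _ h, splice_of_lt _ _ h, splice_of_lt _ _ (by omega)]
      · rw [splice_of_ge _ _ le_rfl, splice_of_lt _ _ (by omega), splice_of_lt _ _ (by omega), hvi]
      · rw [splice_of_ge _ _ h.le, splice_of_ge _ _ (by omega), splice_of_ge _ _ (by omega)]
  rw [← key n le_rfl]
  congr 1
  funext t
  rcases Nat.lt_or_ge t n with h | h
  · rw [splice_of_lt _ _ h]
  · rw [splice_of_ge _ _ h, h2 t h]

/-- A letter that continues the periodic part cannot be one of several possible letters. -/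
theorem apply_eq_of_exists_periodic {x : LeftWord X} {m k : ℕ} (hk : 1 ≤ k)
    (hagree : ∀ y, f y = f x → ∀ t ≥ m + 1, y t = x t)
    (hper : ∀ t ≥ m + 1, x (t + k) = x t) {v : LeftWord X} (hv : f v = f x)
    (hvm : v m = x (m + k)) {u : LeftWord X} (hu : f u = f x) : u m = x (m + k) := by
  -- The word `v` is periodic already from `m`, so its tail at `m + k` may be replaced by that of
  -- `u` at `m`. The new word lies in the fibre and has the letter `u m` at place `m + k`, where all
  -- words of the fibre agree.
  have hloop : shift^[m + k] v = shift^[m] v := by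
    funext s
    rw [shift_iterate_apply, shift_iterate_apply]
    cases s with
    | zero => rw [add_zero, add_zero, hvm, hagree v hv _ (by omega)]
    | succ s =>
      rw [hagree v hv _ (by omega), hagree v hv _ (by omega), ← hper (m + (s + 1)) (by omega)]
      congr 1
      omega
  have hsplice : f (splice (m + k) v fun t => u (t - k)) = f v := by
    refine apply_splice happ ?_
    rw [hloop]
    have : shift^[m + k] (fun t => u (t - k)) = shift^[m] u := by
      funext s
      rw [shift_iterate_apply, shift_iterate_apply]
      congr 1
      omega
    rw [this]
    exact apply_shift_iterate_eq hsh (hv.trans hu.symm) m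
  have := hagree _ (hsplice.trans hv) (m + k) (by omega)
  rw [splice_of_ge _ _ le_rfl, Nat.add_sub_cancel] at this
  exact this

open Classical in
theorem exists_isFormOf [Finite X] {x : LeftWord X} (hfin : (f ⁻¹' {f x}).Finite)
    (horb : (Set.range fun m => shift^[m] x).Finite) (hcrit : ∃ y, f y = f x ∧ y 0 ≠ x 0) :
    ∃ D : ClassForm X, IsFormOf f (f x) D := by
  have hgood : ∃ n, 1 ≤ n ∧ (∀ y, f y = f x → ∀ t ≥ n, y t = x t) ∧
      ∃ p, 1 ≤ p ∧ ∀ t ≥ n, x (t + p) = x t := by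
    obtain ⟨N, hN⟩ := exists_forall_ge_eq happ hsh hfin
    -- A repetition in the finite shift orbit makes `x` eventually periodic with period `b - a`.
    obtain ⟨a, b, hab, e⟩ := horb.exists_lt_map_eq_of_forall_mem
      (f := fun m => shift^[m] x) Set.mem_range_self
    refine ⟨N + a + 1, by omega, fun y hy t ht => hN y hy t (by omega), b - a, by omega,
      fun t ht => ?_⟩
    have := congrFun e (t - a)
    simp only [shift_iterate_apply] at this
    rw [show t + (b - a) = b + (t - a) by omega, ← this]
    congr 1
    omega
  obtain ⟨hn1, hagree, hper⟩ := Nat.find_spec hgood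
  have hmin := fun m => Nat.find_min hgood (m := m)
  set n := Nat.find hgood
  obtain ⟨hk1, hkper⟩ := Nat.find_spec hper
  have hkmin := fun m => Nat.find_min hper (m := m)
  set k := Nat.find hper
  let D : ClassForm X :=
    ⟨List.ofFn fun i : Fin n => (Set.toFinite {a | ∃ v, f v = f x ∧ v i = a}).toFinset,
      List.ofFn fun i : Fin k => x (n + i)⟩
  have hDn : D.S.length = n := List.length_ofFn
  have hDk : D.z.length = k := List.length_ofFn
  have hz : ∀ i, D.z[i % k]? = some (x (n + i)) := by
    intro i
    have hi := Nat.mod_lt i (y := k) (by omega)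
    rw [List.getElem?_eq_getElem (by omega), List.getElem_ofFn]
    have := add_mul_eq_of_add_eq hkper (i / k) (t := n + i % k) (by omega)
    rw [add_assoc, Nat.mod_add_div'] at this
    rw [this]
  -- This is `z_k ∉ S_n`. Otherwise all words of the fibre would share at `n - 1` the letter
  -- continuing the period: for `n > 1` this contradicts the minimality of `n`, for `n = 1` the
  -- existence of two different last letters.
  have hlast : ∀ v, f v = f x → v (n - 1) ≠ x (n + k - 1) := by
    intro v hv e
    have hnk : n + k - 1 = n - 1 + k := by omega
    have hall : ∀ u, f u = f x → u (n - 1) = x (n - 1 + k) := fun u hu =>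
      apply_eq_of_exists_periodic happ hsh hk1 (fun y hy t ht => hagree y hy t (by omega))
        (fun t ht => hkper t (by omega)) hv (hnk ▸ e) hu
    rcases Nat.eq_or_lt_of_le hn1 with h1 | h1
    · obtain ⟨y, hy, hy0⟩ := hcrit
      have h2 := hall y hy
      have h3 := hall x rfl
      rw [← h1] at h2 h3
      exact hy0 (h2.trans h3.symm)
    · refine hmin (n - 1) (by omega) ⟨by omega, fun y hy t ht => ?_, k, hk1, fun t ht => ?_⟩
      · rcases Nat.eq_or_lt_of_le ht with h2 | h2
        · rw [← h2, hall y hy, hall x rfl]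
        · exact hagree y hy t (by omega)
      · rcases Nat.eq_or_lt_of_le ht with h2 | h2
        · rw [← h2, ← hall x rfl]
        · exact hkper t (by omega)
  refine ⟨D, ⟨?_, ?_, ?_, ?_⟩, ?_⟩
  · exact List.ne_nil_of_length_pos (by omega)
  · exact List.ne_nil_of_length_pos (by omega)
  · intro v m hm e
    have hlen : k = m * v.length := by
      rw [← hDk, e]
      simp
    have hv : 1 ≤ v.length := by
      by_contra h0
      have : v.length = 0 := by omega
      rw [this] at hlen
      omega
    have hlt : v.length < k := by
      have := Nat.mul_le_mul_right v.length hm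
      omega
    have hxv : ∀ i, some (x (n + i)) = v[i % v.length]? := fun i => by
      have hi := Nat.mod_lt i (y := k) (by omega)
      rw [← hz, e, getElem?_flatten_replicate _ _ _ (by omega),
        Nat.mod_mod_of_dvd _ ⟨m, by rw [hlen, mul_comm]⟩]
    -- A proper power would give a period shorter than the least one.
    refine hkmin v.length hlt ⟨hv, fun t ht => ?_⟩
    obtain ⟨i, rfl⟩ := Nat.exists_eq_add_of_le ht
    refine Option.some.inj ?_
    rw [add_assoc, hxv, hxv, Nat.add_mod_right]
  · rw [List.getLast_eq_getElem, List.getLast_eq_getElem, List.getElem_ofFn, List.getElem_ofFn]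
    simp only [Set.Finite.mem_toFinset, hDn, hDk]
    rintro ⟨v, hv, e⟩
    refine hlast v hv (e.trans ?_)
    congr 1
    omega
  · ext y
    constructor
    · intro hy
      refine ⟨fun i hi => ?_, fun i => ?_⟩
      · rw [List.getElem_ofFn, Set.Finite.mem_toFinset]
        exact ⟨y, hy, rfl⟩
      · unfold ClassForm.k ClassForm.n
        rw [hDn, hDk, hz, hagree y hy _ (by omega)]
    · rintro ⟨h1, h2⟩
      unfold ClassForm.k ClassForm.n at h2
      rw [hDn, hDk] at h2
      refine apply_eq_of_forall_exists happ hsh (n := n) (fun t ht => ?_) (fun t ht => ?_)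
      · have := h1 t (by omega)
        rw [List.getElem_ofFn, Set.Finite.mem_toFinset] at this
        exact this
      · obtain ⟨i, rfl⟩ := Nat.exists_eq_add_of_le ht
        have := h2 i
        rw [hz] at this
        exact (Option.some.inj this).symm

end Existence

end ClassForm

/-! ### The generators are finitary or directed -/

namespace ClassForm

section Bounded

variable {X : Type u} {D : ClassForm X}

/-- The preceding state on the cycle of the states `n, …, n + k - 1`. -/
def cyclePred (D : ClassForm X) (j : ℕ) : ℕ := if j = D.n then D.n + D.k - 1 else j - 1

theorem cyclePred_iterate (r s : ℕ) : D.cyclePred^[s] (D.n + (r + s)) = D.n + r := by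
  induction s with
  | zero => rfl
  | succ s ih =>
    rw [Function.iterate_succ_apply, ← ih]
    congr 1
    rw [cyclePred, if_neg (by omega)]
    omega

theorem isPeriodicPt_cyclePred {j : ℕ} (h1 : D.n ≤ j) (h2 : j < D.n + D.k) :
    Function.IsPeriodicPt D.cyclePred D.k j := by
  obtain ⟨r, rfl⟩ := Nat.exists_eq_add_of_le h1
  have e1 := cyclePred_iterate (D := D) 0 r
  have e2 := cyclePred_iterate (D := D) r (D.k - 1 - r)
  have e3 : D.cyclePred D.n = D.n + (r + (D.k - 1 - r)) := by
    rw [cyclePred, if_pos rfl]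
    omega
  rw [zero_add] at e1
  change D.cyclePred^[D.k] _ = _
  rw [show D.k = (D.k - 1 - r) + 1 + r by omega, Function.iterate_add_apply, e1,
    Function.iterate_add_apply, add_zero]
  exact (congrArg _ e3).trans e2

variable [LinearOrder X]

theorem sec_gen_singleton (j : ℕ) (a : X) : sec (D.gen j) [a] = D.gen (D.recursion.next j a) :=
  D.recursion.sec_aut j a

theorem sec_gen_cons (j : ℕ) (a : X) (w : List X) :
    sec (D.gen j) (a :: w) = sec (D.gen (D.recursion.next j a)) w := by
  rw [← List.singleton_append, sec_append, sec_gen_singleton]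

theorem next_le_of_lt {j : ℕ} (hj : j < D.n) (a : X) : D.recursion.next j a ≤ j - 1 := by
  rcases D.next_cases j a with h | h | h | h <;> omega

theorem sec_gen_eq_one (hD : D.IsReduced) {j : ℕ} (hj : j < D.n) {w : List X}
    (hw : j ≤ w.length) : sec (D.gen j) w = 1 := by
  induction w generalizing j with
  | nil =>
    obtain rfl : j = 0 := by simpa using hw
    rw [gen_zero hD, sec_one]
  | cons a w ih =>
    have := next_le_of_lt hj a
    rw [List.length_cons] at hw
    rw [sec_gen_cons, ih (by omega) (by omega)]

theorem exists_sec_gen_eq {j : ℕ} (hj : j < D.n) (w : List X) :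
    ∃ i < D.n, sec (D.gen j) w = D.gen i := by
  induction w generalizing j with
  | nil => exact ⟨j, hj, sec_nil _⟩
  | cons a w ih =>
    rw [sec_gen_cons]
    have := next_le_of_lt hj a
    exact ih (by omega)

/-- From a state on the cycle exactly one letter stays on the cycle, and it is fixed; every other
letter leads to a state below `n`, from which there is no return. -/
theorem exists_ray (hD : D.IsReduced) (t : ℕ) {j : ℕ} (h1 : D.n ≤ j) (h2 : j < D.n + D.k) :
    ∃ u : List X, u.length = t ∧ (D.gen j).1 u = u ∧
      sec (D.gen j) u = D.gen (D.cyclePred^[t] j) ∧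
      ∀ w : List X, w.length = t → w ≠ u → ∃ i < D.n, sec (D.gen j) w = D.gen i := by
  induction t generalizing j with
  | zero =>
    refine ⟨[], rfl, rfl, sec_nil _, fun w hw hne => ?_⟩
    exact absurd (List.length_eq_zero_iff.1 hw) hne
  | succ t ih =>
    have hn := hD.one_le_n
    have hk := hD.one_le_k
    obtain ⟨a, ha, ha', hoff⟩ : ∃ a, D.recursion.next j a = D.cyclePred j ∧ a ∉ D.setAt j ∧
        ∀ b, b ≠ a → D.recursion.next j b < D.n := by
      unfold cyclePred
      rcases Nat.eq_or_lt_of_le h1 with rfl | hlt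
      · obtain ⟨a, ha⟩ := exists_isLetter (D := D) hk le_rfl
        refine ⟨a, by rw [if_pos rfl, next_n_of_isLetter hD ha], hD.notMem_of_isLetter ha,
          fun b hb => ?_⟩
        rcases D.next_cases D.n b with h | h | h | h
        · omega
        · exact absurd (h.2.2.1.eq ha) hb
        · omega
        · omega
      · obtain ⟨a, ha⟩ := exists_isLetter (D := D) (j := j - D.n) (by omega) (by omega)
        refine ⟨a, by rw [if_neg hlt.ne', next_of_isLetter hlt ha],
          by simp [setAt_eq_empty hlt], fun b hb => ?_⟩
        rcases D.next_cases j b with h | h | h | h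
        · have := (le_n_of_mem_setAt h.1).2
          omega
        · omega
        · exact absurd (h.2.2.1.eq ha) hb
        · omega
    have hb : D.n ≤ D.cyclePred j ∧ D.cyclePred j < D.n + D.k := by
      unfold cyclePred
      split_ifs <;> omega
    obtain ⟨u, hu, hfix, hsec, hu'⟩ := ih hb.1 hb.2
    refine ⟨a :: u, by simp [hu], ?_, ?_, ?_⟩
    · change D.recursion.perm j a :: D.recursion.act (D.recursion.next j a) u = a :: u
      rw [perm_of_notMem ha', ha]
      exact congrArg _ hfix
    · rw [sec_gen_cons, ha, hsec, Function.iterate_succ_apply]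
    · intro w hw hne
      cases w with
      | nil => simp at hw
      | cons b w =>
        rw [sec_gen_cons]
        by_cases hba : b = a
        · subst hba
          rw [ha]
          exact hu' w (by simpa using hw) fun e => hne (by rw [e])
        · exact exists_sec_gen_eq (hoff b hba) w

theorem gen_mem_basicSet (hD : D.IsReduced) {T : ℕ} (hn : D.n ≤ T) (hk : D.k ∣ T) {j : ℕ}
    (hj : j < D.n + D.k) : D.gen j ∈ basicSet X T := by
  have hfin : ∀ i < D.n, D.gen i ∈ finitary X T := fun i hi w hw =>
    sec_gen_eq_one hD hi (by omega)
  rcases Nat.lt_or_ge j D.n with h | h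
  · exact Or.inl (hfin j h)
  · obtain ⟨u, hu, hfix, hsec, hoff⟩ := exists_ray hD T h hj
    rw [((isPeriodicPt_cyclePred h hj).trans_dvd hk).eq] at hsec
    refine Or.inr ⟨u, hu, hfix, hsec, fun w hw hne => ?_⟩
    obtain ⟨i, hi, e⟩ := hoff w (hw.trans hu) hne
    rw [e, hu]
    exact hfin i hi

/-- The groups generated by the recursions of finitely many reduced forms are contracting. -/
theorem isContracting_closure_gen [Finite X] {𝒟 : Set (ClassForm X)} (hfin : 𝒟.Finite)
    (hred : ∀ D ∈ 𝒟, D.IsReduced) :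
    IsContracting (Subgroup.closure {g | ∃ D ∈ 𝒟, ∃ j < D.n + D.k, g = D.gen j}) := by
  -- A common depth for all forms: at least every `n` and a multiple of every `k`.
  let T := ∏ D ∈ hfin.toFinset, D.n * D.k
  have hT : 0 < T := Finset.prod_pos fun D hD => by
    have := hred D (hfin.mem_toFinset.1 hD)
    exact Nat.mul_pos this.one_le_n this.one_le_k
  have hdvd : ∀ D ∈ 𝒟, D.n * D.k ∣ T := fun D hD =>
    Finset.dvd_prod_of_mem (fun D : ClassForm X => D.n * D.k) (hfin.mem_toFinset.2 hD)
  refine isContracting_closure hT ?_ (isSelfSimilarGroup_closure ?_)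
  · rintro _ ⟨D, hD, j, hj, rfl⟩
    exact gen_mem_basicSet (hred D hD)
      (Nat.le_of_dvd hT ((Nat.dvd_mul_right _ _).trans (hdvd D hD)))
      ((Nat.dvd_mul_left _ _).trans (hdvd D hD)) hj
  · rintro _ ⟨D, hD, j, hj, rfl⟩ x
    rw [sec_gen_singleton]
    exact Subgroup.subset_closure ⟨D, hD, _, next_lt (hred D hD) j hj x, rfl⟩

end Bounded

end ClassForm

/-! ### Critical points -/

section Critical

variable {X : Type u} {K : Type v} {F : X → K → K} {π : LeftWord X → K}

/-- A critical word is determined by its last letter and its shift, which is post-critical. -/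
theorem finite_criticalSet [Finite X] (hpcf : IsPCF F π) : (criticalSet F π).Finite := by
  have hfin : ((Set.univ : Set X) ×ˢ postCriticalSet F π).Finite := Set.finite_univ.prod hpcf
  refine Set.Finite.of_finite_image (f := fun x => (x 0, shift x)) (hfin.subset ?_) ?_
  · rintro _ ⟨x, hx, rfl⟩
    exact ⟨trivial, 1, le_rfl, x, hx, rfl⟩
  · intro x _ y _ h
    rw [← appendLetter_shift x, ← appendLetter_shift y, (Prod.mk.inj h).1, (Prod.mk.inj h).2]

theorem finite_orbit (hpcf : IsPCF F π) {x : LeftWord X} (hx : x ∈ criticalSet F π) :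
    (Set.range fun m => shift^[m] x).Finite := by
  refine (hpcf.insert x).subset ?_
  rintro _ ⟨m, rfl⟩
  cases m with
  | zero => exact Or.inl rfl
  | succ m => exact Or.inr ⟨m + 1, by omega, x, hx, rfl⟩

/-- The forms of the fibres of the critical points. -/
def criticalForms (F : X → K → K) (π : LeftWord X → K) : Set (ClassForm X) :=
  {D | ∃ α ∈ π '' criticalSet F π, IsFormOf π α D}

/-- Allowing `j = 0` adds only the identity and makes the generating set closed under sections. -/
theorem structureGroup_eq [LinearOrder X] :
    structureGroup F π =
      Subgroup.closure {g | ∃ D ∈ criticalForms F π, ∃ j < D.n + D.k, g = D.gen j} := by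
  refine le_antisymm (Subgroup.closure_mono ?_) ((Subgroup.closure_le _).2 ?_)
  · rintro _ ⟨α, hα, D, hD, j, -, hj, rfl⟩
    have := hD.1.one_le_k
    exact ⟨D, ⟨α, hα, hD⟩, j, by omega, rfl⟩
  · rintro _ ⟨D, ⟨α, hα, hD⟩, j, hj, rfl⟩
    rcases Nat.eq_zero_or_pos j with rfl | h
    · rw [ClassForm.gen_zero hD.1]
      exact Subgroup.one_mem _
    · exact Subgroup.subset_closure ⟨α, hα, D, hD, j, h, by omega, rfl⟩

variable [TopologicalSpace X] [TopologicalSpace K]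

/-- Criticality becomes a property of fibres, the form in which the combinatorial lemmas use it. -/
theorem mem_criticalSet_iff (hπ : IsAssociatedSurjection F π) {x : LeftWord X} :
    x ∈ criticalSet F π ↔ ∃ y, π y = π x ∧ y 0 ≠ x 0 := by
  constructor
  · rintro ⟨i, j, hij, ⟨a, ha⟩, b, hb⟩
    obtain ⟨v, rfl⟩ := hπ.surjective a
    obtain ⟨w, rfl⟩ := hπ.surjective b
    rw [hπ.comm] at ha hb
    by_cases h : i = x 0
    · exact ⟨appendLetter j w, hb, fun e => hij (h.trans e.symm)⟩
    · exact ⟨appendLetter i v, ha, h⟩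
  · rintro ⟨y, hy, h⟩
    refine ⟨y 0, x 0, h, ⟨π (shift y), ?_⟩, π (shift x), ?_⟩
    · rw [hπ.comm, appendLetter_shift, hy]
    · rw [hπ.comm, appendLetter_shift]

theorem IsAssociatedSurjection.apply_append_eq (hπ : IsAssociatedSurjection F π) (a : X)
    (x y : LeftWord X) (h : π x = π y) : π (appendLetter a x) = π (appendLetter a y) := by
  rw [← hπ.comm, ← hπ.comm, h]

theorem existsUnique_isFormOf [Finite X] (hπ : IsAssociatedSurjection F π) (hpcf : IsPCF F π)
    (hsh : ∀ x y, π x = π y → π (shift x) = π (shift y)) {α : K}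
    (hα : α ∈ π '' criticalSet F π) : ∃! D : ClassForm X, IsFormOf π α D := by
  obtain ⟨x, hx, rfl⟩ := hα
  have hfib : (π ⁻¹' {π x}).Finite := by
    refine (finite_criticalSet hpcf).subset fun y hy => ?_
    have hy' : π y = π x := hy
    rw [criticalSet, Set.mem_preimage] at hx ⊢
    rwa [hy']
  obtain ⟨D, hD⟩ := ClassForm.exists_isFormOf hπ.apply_append_eq hsh hfib (finite_orbit hpcf hx)
    ((mem_criticalSet_iff hπ).1 hx)
  refine ⟨D, hD, fun D' hD' => ?_⟩
  have hx' : x ∈ D'.words := hD'.2 ▸ rfl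
  exact ClassForm.eq_of_words_eq hD'.1 hD.1 hx' (hD'.2.symm.trans hD.2)

theorem finite_criticalForms [Finite X] (hπ : IsAssociatedSurjection F π) (hpcf : IsPCF F π)
    (hsh : ∀ x y, π x = π y → π (shift x) = π (shift y)) : (criticalForms F π).Finite := by
  have : criticalForms F π = ⋃ α ∈ π '' criticalSet F π, {D | IsFormOf π α D} := by
    ext D
    simp [criticalForms]
  rw [this]
  refine ((finite_criticalSet hpcf).image π).biUnion fun α hα => Set.Subsingleton.finite ?_
  exact fun D hD D' hD' => (existsUnique_isFormOf hπ hpcf hsh hα).unique hD hD'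

theorem limitProj_eq_iff [Finite X] [LinearOrder X] (hπ : IsAssociatedSurjection F π)
    (hpcf : IsPCF F π) (hsh : ∀ x y, π x = π y → π (shift x) = π (shift y)) (x y : LeftWord X) :
    limitProj (structureGroup F π) x = limitProj (structureGroup F π) y ↔ π x = π y := by
  have hiff : limitProj (structureGroup F π) x = limitProj (structureGroup F π) y ↔
      AsympEquiv (structureGroup F π) x y := Quotient.eq (r := asympSetoid (structureGroup F π))
  rw [hiff, structureGroup_eq]
  constructor
  · refine ClassForm.eq_of_asympEquiv (finite_criticalForms hπ hpcf hsh) ?_ ?_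
      hπ.apply_append_eq hsh ?_
    · rintro D ⟨_, _, hD⟩
      exact hD.1
    · rintro D ⟨_, ⟨x, _, rfl⟩, hD⟩ j h1 h2
      have hx : x ∈ D.words := hD.2 ▸ rfl
      exact ClassForm.setAt_nonempty hx h1 h2
    · rintro D ⟨α, _, hD⟩ x hx y hy
      rw [← hD.2] at hx hy
      exact hx.trans hy.symm
  · have hcrit : ∀ x y, π x = π y → x 0 ≠ y 0 → π x ∈ π '' criticalSet F π := fun x y hxy h =>
      ⟨x, (mem_criticalSet_iff hπ).2 ⟨y, hxy.symm, h.symm⟩, rfl⟩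
    refine fun h => (ClassForm.rigidEquiv_of_eq hπ.apply_append_eq hsh ?_ ?_ h).asympEquiv
    · exact fun x y hxy h => (existsUnique_isFormOf hπ hpcf hsh (hcrit x y hxy h)).exists
    · exact fun x y hxy h D hD j hj =>
        Subgroup.subset_closure ⟨D, ⟨_, hcrit x y hxy h, hD⟩, j, hj, rfl⟩

end Critical

/-! ### The limit space -/

section LimitSpace

variable {X : Type u} [TopologicalSpace X] {K : Type v} [TopologicalSpace K]
  {G : Subgroup (treeAut X)} {π : LeftWord X → K}

/-- A continuous surjection from a compact space onto a Hausdorff one is closed, hence a quotient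
map; two quotient maps with the same fibres have homeomorphic targets. -/
theorem exists_homeomorph_limitSpace [CompactSpace (LeftWord X)] [T2Space K]
    (hc : Continuous π) (hs : Function.Surjective π)
    (h : ∀ x y, limitProj G x = limitProj G y ↔ π x = π y) :
    ∃ e : K ≃ₜ LimitSpace G, ∀ x, e (π x) = limitProj G x := by
  have hq : Topology.IsQuotientMap π := hc.isClosedMap.isQuotientMap hc hs
  have hp : Topology.IsQuotientMap (limitProj G) := isQuotientMap_quot_mk
  let f : K → LimitSpace G := fun a => limitProj G (Function.surjInv hs a)
  let g : LimitSpace G → K := fun b => π (Function.surjInv hp.surjective b)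
  have hf : ∀ x, f (π x) = limitProj G x := fun x => (h _ _).2 (Function.surjInv_eq hs _)
  have hg : ∀ x, g (limitProj G x) = π x := fun x =>
    (h _ _).1 (Function.surjInv_eq hp.surjective _)
  refine ⟨⟨⟨f, g, fun a => ?_, fun b => ?_⟩, ?_, ?_⟩, hf⟩
  · obtain ⟨x, rfl⟩ := hs a
    rw [hf, hg]
  · obtain ⟨x, rfl⟩ := hp.surjective b
    rw [hg, hf]
  · refine hq.continuous_iff.2 ?_
    rw [show f ∘ π = limitProj G from funext hf]
    exact hp.continuous
  · refine hp.continuous_iff.2 ?_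
    rw [show g ∘ limitProj G = π from funext hg]
    exact hc

theorem IsAssociatedSurjection.conj {L : Type*} [TopologicalSpace L] {F : X → K → K}
    (hπ : IsAssociatedSurjection F π) (e : K ≃ₜ L) :
    IsAssociatedSurjection (fun i b => e (F i (e.symm b))) (e ∘ π) where
  continuous := e.continuous.comp hπ.continuous
  surjective := e.surjective.comp hπ.surjective
  comm i x := by simp [hπ.comm]

theorem IsSelfSimilarStructure.conj {L : Type*} [TopologicalSpace L] {F : X → K → K}
    (hF : IsSelfSimilarStructure F) (e : K ≃ₜ L) :
    IsSelfSimilarStructure fun i b => e (F i (e.symm b)) where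
  compactSpace := by
    have := hF.compactSpace
    exact e.compactSpace
  metrizableSpace := by
    have := hF.metrizableSpace
    exact e.symm.isEmbedding.metrizableSpace
  continuous i := e.continuous.comp ((hF.continuous i).comp e.symm.continuous)
  injective i := e.injective.comp ((hF.injective i).comp e.symm.injective)
  exists_surjection := by
    obtain ⟨π, hπ⟩ := hF.exists_surjection
    exact ⟨_, hπ.conj e⟩

end LimitSpace

end SelfSim

end

open SelfSim in
theorem mainTheorem4 {X : Type*} [Finite X] [LinearOrder X] [TopologicalSpace X]
    [DiscreteTopology X] {K : Type*} [TopologicalSpace K]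
    (F : X → K → K) (hF : IsSelfSimilarStructure F)
    (π : LeftWord X → K) (hπ : IsAssociatedSurjection F π)
    (hpcf : IsPCF F π)
    (hshift : ∃ s : K → K, ∀ x, s (π x) = π (shift x)) :
    (∀ α ∈ π '' criticalSet F π, ∃! D : ClassForm X, IsFormOf π α D) ∧
    IsContracting (structureGroup F π) ∧
    (∀ x y : LeftWord X,
      limitProj (structureGroup F π) x = limitProj (structureGroup F π) y ↔ π x = π y) ∧
    ∃ F' : X → LimitSpace (structureGroup F π) → LimitSpace (structureGroup F π),
      IsSelfSimilarStructure F' ∧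
      IsAssociatedSurjection F' (limitProj (structureGroup F π)) ∧
      AreIsomorphic F F' ∧
      ∃ h : K ≃ₜ LimitSpace (structureGroup F π),
        ∀ x, h (π x) = limitProj (structureGroup F π) x := by
  have hsh : ∀ x y, π x = π y → π (shift x) = π (shift y) := by
    obtain ⟨s, hs⟩ := hshift
    intro x y h
    rw [← hs, ← hs, h]
  have hiff := limitProj_eq_iff hπ hpcf hsh
  have := hF.metrizableSpace
  obtain ⟨e, he⟩ := exists_homeomorph_limitSpace hπ.continuous hπ.surjective hiff
  -- The maps on the limit space are the conjugates of the `F_i` by `e`; their associated surjection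
  -- `e ∘ π` is `p` itself.
  have hp := hπ.conj e
  rw [show e ∘ π = limitProj (structureGroup F π) from funext he] at hp
  refine ⟨fun α hα => existsUnique_isFormOf hπ hpcf hsh hα, ?_, hiff, _, hF.conj e, hp,
    ⟨π, _, hπ, hp, Equiv.refl X, e, he⟩, e, he⟩
  rw [structureGroup_eq]
  refine ClassForm.isContracting_closure_gen (finite_criticalForms hπ hpcf hsh) ?_
  rintro D ⟨_, _, hD⟩
  exact hD.1
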